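/- **Model.** There are $n$ parties; each party has an opinion $0$ or $1$, or the special value $\bot$ (no opinion yet), and initially at least one party has an opinion. *Slush* with sample size $k$ and threshold $\alpha$ proceeds in synchronous rounds. In each round, every party that has an opinion independently samples $k$ parties uniformly at random, with repetition, from all $n$ parties and sends each of them a query containing its opinion. A party with value $\bot$ that receives a query adopts the opinion in the first query that reaches it (the order of arrival is arbitrary). Queried parties reply with their opinions, and every party that had an opinion at the start of the round adopts the opinion $b\in\{0,1\}$ if at least $\alpha$ of its $k$ replies are $b$, and keeps its opinion if there is no such $b$. The protocol has no maximum round. An *$F$-bounded adversary* may, at the beginning of each round, set the opinions of up to $F$ parties to values in $\{0,1\}$; its choice may be randomized and may depend on the whole history of the execution, but not on the samples of the coming round. For a function $g:\mathbb N\to\mathbb R$ with $g(n)=o(n)$, the system is in a state of *stable consensus* if at least $n-g(n)$ parties have the same opinion in $\{0,1\}$. A function $\nu:\mathbb R\to\mathbb R$ is *negligible* if for every polynomial $\pi$ with positive leading coefficient there is $\beta_0\ge 0$ with $\nu(\beta)\le 1/\pi(\beta)$ for all $\beta\ge\beta_0$. **Corollary.** Let $k\ge 2$ and $\alpha=\lceil\frac{k+1}{2}\rceil$.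 Then Slush reaches a stable consensus in $O(\log n+\beta)$ rounds with all but negligible probability with respect to $\beta$, even in the presence of a $\sqrt n$-bounded adversary. That is, there are a constant $C>0$, a function $g(n)=o(n)$ and a negligible function $\nu$, depending only on $k$, such that for all $n\ge 1$, all $\beta\ge 0$, all initial states in which some party has an opinion, all $\sqrt n$-bounded adversaries and all orders of arrival of the queries, the probability that Slush is in a state of stable consensus neither initially nor after any of its first $\lfloor C(\log n+\beta)\rfloor$ rounds is at most $\nu(\beta)$. -/

import Mathlib

/-- The local states of the `n` parties: `some b` is the opinion `b ∈ {0, 1}`,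
`none` is the special value `⊥` of a party that has no opinion yet. -/
abbrev NetState (n : ℕ) := Fin n → Option Bool

/-- The random choices of one round: `s j l` is the `l`-th party sampled by party `j`. -/
abbrev Samples (n k : ℕ) := Fin n → Fin k → Fin n

instance instNonemptySamples (n k : ℕ) : Nonempty (Samples n k) := ⟨fun j _ => j⟩

/-- Party `j` queries party `i`: only parties that have an opinion send queries. -/
def Queries {n k : ℕ} (z : NetState n) (s : Samples n k) (j i : Fin n) : Prop :=
  z j ≠ none ∧ ∃ l, s j l = i

open Classical in
/-- The local values after all queries of a round have been received, where `first i` is the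
party whose query reaches `i` first. A party with an opinion keeps it; a party with value `⊥`
that is queried adopts the opinion contained in the first query it receives. These are also the
values that are sent as replies. -/
noncomputable def afterQueries {n k : ℕ} (z : NetState n) (s : Samples n k)
    (first : Fin n → Fin n) : NetState n := fun i =>
  if z i = none ∧ ∃ j, Queries z s j i then z (first i) else z i

/-- The number of replies with opinion `b` that party `j` obtains (with multiplicity). -/
def votes {n k : ℕ} (y : NetState n) (s : Samples n k) (j : Fin n) (b : Bool) : ℕ :=
  (Finset.univ.filter fun l : Fin k => y (s j l) = some b).card

/-- One synchronous round of Slush with majority threshold `α`, started in the state `z`. -/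
noncomputable def slushStep {n k : ℕ} (α : ℕ) (z : NetState n) (s : Samples n k)
    (first : Fin n → Fin n) : NetState n := fun j =>
  let y := afterQueries z s first
  if z j = none then y j
  else if α ≤ votes y s j true then some true
  else if α ≤ votes y s j false then some false
  else z j

/-- The history of an execution: the initial state, followed by one entry for every completed
round. The entry `round h z s x` extends `h` by a round in which the adversary changed the current
state to `z`, the parties drew the samples `s`, and the state after the round was `x`. -/
inductive History (n k : ℕ) where
  | init (x : NetState n) : History n k
  | round (h : History n k) (z : NetState n) (s : Samples n k) (x : NetState n) : History n k

/-- The state at the end of a history. -/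
def History.current {n k : ℕ} : History n k → NetState n
  | .init x => x
  | .round _ _ _ x => x

/-- An adaptive, randomized `F`-bounded adversary: at the beginning of each round, knowing the
whole history (but not the samples of the coming round), it sets the values of at most `F` parties
to opinions in `{0, 1}`. `strategy h` is the law of the resulting state. -/
structure BoundedAdversary (n k : ℕ) (F : ℝ) where
  strategy : History n k → PMF (NetState n)
  card_le : ∀ h, ∀ z ∈ (strategy h).support,
    ((Finset.univ.filter fun i => z i ≠ h.current i).card : ℝ) ≤ F
  opinion : ∀ h, ∀ z ∈ (strategy h).support, ∀ i, z i ≠ h.current i → z i ≠ none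

/-- An arbitrary, possibly random and history-dependent order of arrival of the queries sent in
the same round; only the sender `first i` of the query that reaches `i` first matters. -/
structure ArrivalOrder (n k : ℕ) where
  law : History n k → NetState n → Samples n k → PMF (Fin n → Fin n)
  first_queries : ∀ h z s, ∀ first ∈ (law h z s).support, ∀ i,
    (∃ j, Queries z s j i) → Queries z s (first i) i

/-- The law of the history of the first `t` rounds of Slush with sample size `k` and threshold `α`,
started in `x₀`. In each round the adversary acts first; then every party samples `k` parties
independently and uniformly, with repetition, from all `n` parties. -/
noncomputable def slushLaw {n k : ℕ} {F : ℝ} (α : ℕ) (A : BoundedAdversary n k F)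
    (O : ArrivalOrder n k) (x₀ : NetState n) : ℕ → PMF (History n k)
  | 0 => PMF.pure (.init x₀)
  | t + 1 =>
    (slushLaw α A O x₀ t).bind fun h =>
    (A.strategy h).bind fun z =>
    (PMF.uniformOfFintype (Samples n k)).bind fun s =>
    (O.law h z s).map fun first => .round h z s (slushStep α z s first)

/-- At least `n - g n` of the `n` parties have the same opinion in `{0, 1}`. For a function
`g ∈ o(n)` this is the state of stable consensus. -/
def IsStableConsensus (g : ℕ → ℝ) {n : ℕ} (x : NetState n) : Prop :=
  ∃ b : Bool, (n : ℝ) - g n ≤ ((Finset.univ.filter fun i => x i = some b).card : ℝ)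

/-- Stable consensus holds initially or after at least one of the rounds of the history. -/
def History.Reaches (g : ℕ → ℝ) {n k : ℕ} : History n k → Prop
  | .init x => IsStableConsensus g x
  | .round h _ _ x => h.Reaches g ∨ IsStableConsensus g x

/-- `f` is negligible: it is eventually below `1 / p` for every polynomial `p` that is eventually
positive. -/
def Negligible (f : ℝ → ℝ) : Prop :=
  ∀ p : Polynomial ℝ, 0 < p.leadingCoeff → ∃ b₀ : ℝ, 0 ≤ b₀ ∧ ∀ b ≥ b₀, f b ≤ 1 / p.eval b

/-! The proof is a potential argument. A function `V` of the state shrinks in mean by a constant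
factor `ρ < 1` in every round that starts without stable consensus, whatever the adversary and the
arrival order do. Off consensus `V ≥ 1/n`, and initially `V ≤ n ^ 4`, so Markov's inequality bounds
the probability of having missed consensus for `t` rounds by `n ^ 5 * ρ ^ t`. This is exponentially
small in `β` once `t` is of order `log n + β`.

The potential `potential` handles two phases at once.

Spreading: while some party is undecided, the odds undecided/decided contract, because each
undecided party is queried with probability at least of the order of the decided fraction, and one
round increases the number of decided parties by at most a factor `k + 1`
(`expect_oddsOf_unqueried_le`). The weight `n ^ 2` makes this term dominate whatever ratio of
opinions is present when the last party becomes decided (`expect_spread_le`).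

Consensus: when all parties are decided, let `S` be the difference of the two camps. The potential
is (minority size) / `max |S| (K√n)`. If `|S| ≥ K√n`, the majority rule gives a drift `δ|S|(1 -
|S|/n)` (`tail_drift`, `le_sum_expect_signUpdated`); it beats both the adversary, who moves `S` by
at most `2√n`, and the fluctuations, which are controlled by a Chernoff bound
(`expect_minorityRatio_far_le`). If `|S| ≤ K√n`, the drift is useless, but the variance of the next
`S` is of order `n`, so with constant probability it jumps to `2K√n` and the ratio is at most about
half (`expect_minorityRatio_near_le`).

The adversary can maintain a minority of order `√n`; consensus is therefore measured with the gap `n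
^ (3/4)`, below which the drift need not win. -/

open scoped BigOperators ENNReal
open Finset

/-! ### Expectations under discrete laws and the supermartingale argument. -/

namespace Slush

/-- The expectation of a nonnegative function under a discrete law. -/
noncomputable def mean {A : Type*} (p : PMF A) (f : A → ℝ≥0∞) : ℝ≥0∞ := ∑' a, p a * f a

theorem mean_pure {A : Type*} (a : A) (f : A → ℝ≥0∞) : mean (PMF.pure a) f = f a := by
  classical
  simp [mean, PMF.pure_apply]

theorem mean_bind {A B : Type*} (p : PMF A) (q : A → PMF B) (f : B → ℝ≥0∞) :
    mean (p.bind q) f = mean p fun a => mean (q a) f := by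
  simp only [mean, PMF.bind_apply, ← ENNReal.tsum_mul_right, ← ENNReal.tsum_mul_left]
  rw [ENNReal.tsum_comm]
  simp only [mul_assoc]

theorem mean_map {A B : Type*} (p : PMF A) (q : A → B) (f : B → ℝ≥0∞) :
    mean (p.map q) f = mean p fun a => f (q a) := by
  simp [PMF.map, mean_bind, mean_pure]

theorem mean_mono {A : Type*} (p : PMF A) {f g : A → ℝ≥0∞} (h : ∀ a ∈ p.support, f a ≤ g a) :
    mean p f ≤ mean p g := by
  refine ENNReal.tsum_le_tsum fun a => ?_
  by_cases ha : a ∈ p.support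
  · exact mul_le_mul_right (h a ha) _
  · simp [(PMF.apply_eq_zero_iff p a).2 ha]

theorem mean_le_of_forall_le {A : Type*} (p : PMF A) {f : A → ℝ≥0∞} {c : ℝ≥0∞}
    (h : ∀ a ∈ p.support, f a ≤ c) : mean p f ≤ c :=
  (mean_mono p (g := fun _ => c) h).trans (by simp [mean, ENNReal.tsum_mul_right, p.tsum_coe])

theorem mean_const_mul {A : Type*} (p : PMF A) (c : ℝ≥0∞) (f : A → ℝ≥0∞) :
    mean p (fun a => c * f a) = c * mean p f := by
  simp only [mean, ← ENNReal.tsum_mul_left, mul_left_comm]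

theorem toOuterMeasure_mul_le_mean {A : Type*} (p : PMF A) (S : Set A) (c : ℝ≥0∞)
    {f : A → ℝ≥0∞} (h : ∀ a ∈ S, c ≤ f a) : p.toOuterMeasure S * c ≤ mean p f := by
  rw [PMF.toOuterMeasure_apply, ← ENNReal.tsum_mul_right]
  refine ENNReal.tsum_le_tsum fun a => ?_
  by_cases ha : a ∈ S
  · simpa [ha] using mul_le_mul_right (h a ha) _
  · simp [ha]

theorem mean_uniform_ofReal {A : Type*} [Fintype A] [Nonempty A] (f : A → ℝ) (hf : ∀ a, 0 ≤ f a) :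
    mean (PMF.uniformOfFintype A) (fun a => ENNReal.ofReal (f a))
      = ENNReal.ofReal (Finset.univ.expect f) := by
  have h0 : (0 : ℝ) < Fintype.card A := by exact_mod_cast Fintype.card_pos
  rw [mean, tsum_fintype, Fintype.expect_eq_sum_div_card, div_eq_mul_inv, mul_comm,
    ENNReal.ofReal_mul (by positivity), ENNReal.ofReal_inv_of_pos h0, ENNReal.ofReal_natCast,
    ENNReal.ofReal_sum_of_nonneg (fun a _ => hf a), Finset.mul_sum]
  simp [PMF.uniformOfFintype_apply]

variable {n k : ℕ}

/-- `first` picks, for every queried party, one of the parties that query it. -/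
def IsArrival (z : NetState n) (s : Samples n k) (first : Fin n → Fin n) : Prop :=
  ∀ i, (∃ j, Queries z s j i) → Queries z s (first i) i

/-- `z` can be obtained from `x` by giving opinions to at most `F` parties. -/
def IsCorruption (F : ℝ) (x z : NetState n) : Prop :=
  ((Finset.univ.filter fun i => z i ≠ x i).card : ℝ) ≤ F ∧ ∀ i, z i ≠ x i → z i ≠ none

/-- `V` shrinks in mean by the factor `ρ` in every round that starts without stable consensus. -/
def IsContracting (k α : ℕ) (g : ℕ → ℝ) (F : ℝ) (V : NetState n → ℝ≥0∞) (ρ : ℝ≥0∞) : Prop :=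
  ∀ x z : NetState n, ¬ IsStableConsensus g x → IsCorruption F x z →
    ∃ B : Samples n k → ℝ≥0∞,
      (∀ s first, IsArrival z s first → V (slushStep α z s first) ≤ B s) ∧
      mean (PMF.uniformOfFintype (Samples n k)) B ≤ ρ * V x

theorem _root_.History.Reaches.of_current {g : ℕ → ℝ} {h : History n k}
    (hx : IsStableConsensus g h.current) : h.Reaches g := by
  cases h with
  | init x => exact hx
  | round h z s x => exact Or.inr hx

-- The potential is set to zero once consensus has been reached, which turns it into a
-- supermartingale even though nothing is known about `V` after that time. The majorant `B` in
-- `IsContracting` does not depend on the arrival order, so that order may be chosen after the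
-- samples.
open Classical in
theorem mean_slushLaw_le {α : ℕ} {g : ℕ → ℝ} {F : ℝ} {V : NetState n → ℝ≥0∞} {ρ : ℝ≥0∞}
    (hV : IsContracting k α g F V ρ) (A : BoundedAdversary n k F) (O : ArrivalOrder n k)
    (x₀ : NetState n) (t : ℕ) :
    mean (slushLaw α A O x₀ t) (fun h => if h.Reaches g then 0 else V h.current)
      ≤ ρ ^ t * V x₀ := by
  induction t with
  | zero =>
    rw [slushLaw, mean_pure]
    split_ifs <;> simp [History.current]
  | succ t ih =>
    rw [slushLaw, mean_bind]
    calc _ ≤ mean (slushLaw α A O x₀ t)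
          (fun h => ρ * if h.Reaches g then 0 else V h.current) := by
          refine mean_mono _ fun h _ => ?_
          rw [mean_bind]
          by_cases hr : h.Reaches g
          · refine mean_le_of_forall_le _ fun z _ => ?_
            rw [mean_bind]
            refine mean_le_of_forall_le _ fun s _ => ?_
            rw [mean_map]
            exact mean_le_of_forall_le _ fun first _ => by simp [History.Reaches, hr]
          · rw [if_neg hr]
            refine mean_le_of_forall_le _ fun z hz => ?_
            obtain ⟨B, hB, hle⟩ := hV h.current z (fun hx => hr (.of_current hx))
              ⟨A.card_le h z hz, A.opinion h z hz⟩
            rw [mean_bind]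
            refine le_trans (mean_mono _ fun s _ => ?_) hle
            rw [mean_map]
            refine mean_le_of_forall_le _ fun first hf => ?_
            refine le_trans ?_ (hB s first (O.first_queries h z s first hf))
            split_ifs <;> simp [History.current]
      _ ≤ ρ * (ρ ^ t * V x₀) := by
          rw [mean_const_mul]
          exact mul_le_mul_right ih _
      _ = _ := by rw [pow_succ']; ring

theorem not_reaches_mul_le {α : ℕ} {g : ℕ → ℝ} {F : ℝ} {V : NetState n → ℝ≥0∞} {ρ c : ℝ≥0∞}
    (hV : IsContracting k α g F V ρ) (hc : ∀ x, ¬ IsStableConsensus g x → c ≤ V x)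
    (A : BoundedAdversary n k F) (O : ArrivalOrder n k) (x₀ : NetState n) (t : ℕ) :
    (slushLaw α A O x₀ t).toOuterMeasure {h | ¬ h.Reaches g} * c ≤ ρ ^ t * V x₀ := by
  classical
  refine (toOuterMeasure_mul_le_mean _ _ _ fun h hh => ?_).trans (mean_slushLaw_le hV A O x₀ t)
  rw [if_neg hh]
  exact hc _ fun hx => hh (.of_current hx)

end Slush

/-! ### Exponential moments: concentration and anti-concentration of independent sums. -/

namespace Slush

section Averages

variable {ι Ω : Type*} [Fintype ι] [Fintype Ω]

theorem expect_pi_prod [DecidableEq ι] (f : ι → Ω → ℝ) :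
    𝔼 s : ι → Ω, ∏ j, f j (s j) = ∏ j, 𝔼 r, f j r := by
  classical
  simp only [Fintype.expect_eq_sum_div_card, Finset.prod_div_distrib, Finset.prod_const]
  rw [Finset.prod_univ_sum]
  simp [Fintype.piFinset_univ]

/-- The deviation of a sum of independent variables from its mean. -/
noncomputable def deviation (y : ι → Ω → ℝ) (s : ι → Ω) : ℝ :=
  ∑ j, y j (s j) - ∑ j, 𝔼 r, y j r

theorem expect_exp_deviation [DecidableEq ι] (y : ι → Ω → ℝ) (t : ℝ) :
    𝔼 s, Real.exp (t * deviation y s) = ∏ j, 𝔼 r, Real.exp (t * (y j r - 𝔼 r, y j r)) := by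
  rw [← expect_pi_prod]
  refine Finset.expect_congr rfl fun s _ => ?_
  rw [deviation, ← Finset.sum_sub_distrib, Finset.mul_sum, Real.exp_sum]

variable [Nonempty Ω]

theorem expect_pi_apply [DecidableEq ι] (j : ι) (f : Ω → ℝ) :
    𝔼 s : ι → Ω, f (s j) = 𝔼 r, f r := by
  have h := expect_pi_prod fun i r => if i = j then f r else 1
  simp only [Finset.prod_ite_eq', mem_univ, if_true] at h
  rw [h, Finset.prod_eq_single j _ (by simp)]
  · simp
  · intro i _ hi
    simp [hi]

theorem expect_add_mul_centered {y : Ω → ℝ} (t e : ℝ) :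
    𝔼 r, (1 + t * (y r - 𝔼 r, y r) + e * (y r - 𝔼 r, y r) ^ 2)
      = 1 + e * 𝔼 r, (y r - 𝔼 r, y r) ^ 2 := by
  rw [Finset.expect_add_distrib, Finset.expect_add_distrib, ← Finset.mul_expect,
    ← Finset.mul_expect, Finset.expect_sub_distrib, Fintype.expect_const, Fintype.expect_const]
  ring

theorem expect_centered_sq (y : Ω → ℝ) :
    𝔼 r, (y r - 𝔼 r, y r) ^ 2 = 𝔼 r, y r ^ 2 - (𝔼 r, y r) ^ 2 := by
  have : ∀ r, (y r - 𝔼 r, y r) ^ 2 = y r ^ 2 - 2 * (𝔼 r, y r) * y r + (𝔼 r, y r) ^ 2 :=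
    fun r => by ring
  simp_rw [this]
  rw [Finset.expect_add_distrib, Finset.expect_sub_distrib, ← Finset.mul_expect,
    Fintype.expect_const]
  ring

theorem abs_expect_le_one {y : Ω → ℝ} (hy : ∀ r, |y r| ≤ 1) : |𝔼 r, y r| ≤ 1 :=
  (Finset.abs_expect_le _ _).trans (Finset.expect_le univ_nonempty fun r _ => hy r)

theorem abs_mul_centered_le {y : Ω → ℝ} (hy : ∀ r, |y r| ≤ 1) {t : ℝ} (ht : |t| ≤ 1 / 2) (r : Ω) :
    |t * (y r - 𝔼 r, y r)| ≤ 1 := by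
  have h2 : |y r - 𝔼 r, y r| ≤ 2 := by
    have := abs_sub (y r) (𝔼 r, y r)
    linarith [hy r, abs_expect_le_one hy]
  rw [abs_mul]
  nlinarith [abs_nonneg t, abs_nonneg (y r - 𝔼 r, y r)]

/-- The centered variable is at most 2 in absolute value, so the exponent stays in `[-1, 1]`, where
`exp x ≤ 1 + x + x ^ 2`. The linear term averages out and the variance is at most 1. -/
theorem expect_exp_centered_le {y : Ω → ℝ} (hy : ∀ r, |y r| ≤ 1) {t : ℝ} (ht : |t| ≤ 1 / 2) :
    𝔼 r, Real.exp (t * (y r - 𝔼 r, y r)) ≤ Real.exp (t ^ 2) := by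
  have hv : 𝔼 r, (y r - 𝔼 r, y r) ^ 2 ≤ 1 := by
    rw [expect_centered_sq]
    have : 𝔼 r, y r ^ 2 ≤ 1 :=
      Finset.expect_le univ_nonempty fun r _ => (sq_le_one_iff_abs_le_one _).2 (hy r)
    nlinarith [sq_nonneg (𝔼 r, y r)]
  calc 𝔼 r, Real.exp (t * (y r - 𝔼 r, y r))
      ≤ 𝔼 r, (1 + t * (y r - 𝔼 r, y r) + t ^ 2 * (y r - 𝔼 r, y r) ^ 2) := by
        refine Finset.expect_le_expect fun r _ => ?_
        have := (abs_le.1 (Real.abs_exp_sub_one_sub_id_le (abs_mul_centered_le hy ht r))).2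
        nlinarith
    _ = 1 + t ^ 2 * 𝔼 r, (y r - 𝔼 r, y r) ^ 2 := expect_add_mul_centered _ _
    _ ≤ t ^ 2 + 1 := by nlinarith [sq_nonneg t]
    _ ≤ _ := Real.add_one_le_exp _

theorem le_exp_quadratic {x : ℝ} (hx : |x| ≤ 1) : 1 + x + x ^ 2 / 4 ≤ Real.exp x := by
  have h := (abs_le.1 (Real.exp_bound hx (n := 3) (by norm_num))).1
  simp only [Finset.sum_range_succ, Finset.sum_range_zero, Nat.factorial] at h
  have h3 : |x| ^ 3 ≤ x ^ 2 := by
    rw [← sq_abs x]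
    nlinarith [abs_nonneg x, sq_nonneg |x|]
  norm_num at h
  nlinarith [sq_nonneg x]

theorem le_expect_exp_centered {y : Ω → ℝ} (hy : ∀ r, |y r| ≤ 1) {t : ℝ} (ht : |t| ≤ 1 / 2)
    {v : ℝ} (hv0 : 0 ≤ v) (hv1 : v ≤ 1) (hv : v ≤ 𝔼 r, (y r - 𝔼 r, y r) ^ 2) :
    Real.exp (t ^ 2 * v / 8) ≤ 𝔼 r, Real.exp (t * (y r - 𝔼 r, y r)) := by
  have ht2 : t ^ 2 ≤ 1 / 4 := by
    rw [← sq_abs]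
    nlinarith [abs_nonneg t]
  have hx : |t ^ 2 * v / 8| ≤ 1 := by
    rw [abs_of_nonneg (by positivity)]
    nlinarith [sq_nonneg t]
  have h1 := (abs_le.1 (Real.abs_exp_sub_one_sub_id_le hx)).2
  calc Real.exp (t ^ 2 * v / 8) ≤ 1 + t ^ 2 / 4 * v := by
        have : (t ^ 2 * v / 8) ^ 2 ≤ t ^ 2 * v / 8 := by
          have h0 : 0 ≤ t ^ 2 * v / 8 := by positivity
          rw [abs_of_nonneg h0] at hx
          nlinarith
        linarith
    _ ≤ 1 + t ^ 2 / 4 * 𝔼 r, (y r - 𝔼 r, y r) ^ 2 := by gcongr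
    _ = 𝔼 r, (1 + t * (y r - 𝔼 r, y r) + t ^ 2 / 4 * (y r - 𝔼 r, y r) ^ 2) :=
        (expect_add_mul_centered _ _).symm
    _ ≤ _ := by
        refine Finset.expect_le_expect fun r _ => ?_
        have := le_exp_quadratic (abs_mul_centered_le hy ht r)
        linarith [mul_pow t (y r - 𝔼 r, y r) 2]

theorem expect_exp_deviation_le [DecidableEq ι] {y : ι → Ω → ℝ} (hy : ∀ j r, |y j r| ≤ 1) {t : ℝ}
    (ht : |t| ≤ 1 / 2) :
    𝔼 s, Real.exp (t * deviation y s) ≤ Real.exp (Fintype.card ι * t ^ 2) := by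
  rw [expect_exp_deviation, Real.exp_nat_mul]
  calc _ ≤ ∏ _j : ι, Real.exp (t ^ 2) :=
        Finset.prod_le_prod (fun j _ => Finset.expect_nonneg fun r _ => (Real.exp_pos _).le)
          fun j _ => expect_exp_centered_le (hy j) ht
    _ = _ := by simp

theorem le_expect_exp_deviation [DecidableEq ι] {y : ι → Ω → ℝ} (hy : ∀ j r, |y j r| ≤ 1) {t : ℝ}
    (ht : |t| ≤ 1 / 2) {v : ℝ} (hv0 : 0 ≤ v) (hv1 : v ≤ 1)
    (hv : ∀ j, v ≤ 𝔼 r, (y j r - 𝔼 r, y j r) ^ 2) :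
    Real.exp (Fintype.card ι * (t ^ 2 * v / 8)) ≤ 𝔼 s, Real.exp (t * deviation y s) := by
  rw [expect_exp_deviation, Real.exp_nat_mul]
  calc _ = ∏ _j : ι, Real.exp (t ^ 2 * v / 8) := by simp
    _ ≤ _ := Finset.prod_le_prod (fun j _ => (Real.exp_pos _).le)
          fun j _ => le_expect_exp_centered (hy j) ht hv0 hv1 (hv j)

open Classical in
/-- A Chernoff bound. -/
theorem expect_deviation_lt_le [DecidableEq ι] {y : ι → Ω → ℝ} (hy : ∀ j r, |y j r| ≤ 1) {r : ℝ}
    (hr0 : 0 ≤ r) (hr : r ≤ Fintype.card ι) :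
    𝔼 s, (if deviation y s < -r then (1 : ℝ) else 0)
      ≤ Real.exp (-(r ^ 2 / (4 * Fintype.card ι))) := by
  rcases (Nat.cast_nonneg (α := ℝ) (Fintype.card ι)).eq_or_lt with h0 | h0
  -- For an empty index set the quotient is `0` by convention, and the bound is the trivial `1`.
  · rw [← h0]
    simp only [mul_zero, div_zero, neg_zero, Real.exp_zero]
    exact Finset.expect_le univ_nonempty fun s _ => by split_ifs <;> norm_num
  set N : ℝ := (Fintype.card ι : ℝ)
  -- The exponent `t = -r / (2N)` minimises `N t ^ 2 + t r`.
  have ht : |-(r / (2 * N))| ≤ 1 / 2 := by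
    rw [abs_neg, abs_of_nonneg (by positivity), div_le_iff₀ (by positivity)]
    linarith
  calc 𝔼 s, (if deviation y s < -r then (1 : ℝ) else 0)
      ≤ 𝔼 s, Real.exp (-(r / (2 * N)) * deviation y s) * Real.exp (-(r / (2 * N) * r)) := by
        refine Finset.expect_le_expect fun s _ => ?_
        split_ifs with h
        · rw [← Real.exp_add]
          refine Real.one_le_exp ?_
          have : 0 ≤ r / (2 * N) := by positivity
          nlinarith
        · positivity
    _ = (𝔼 s, Real.exp (-(r / (2 * N)) * deviation y s)) * Real.exp (-(r / (2 * N) * r)) :=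
        (Finset.expect_mul _ _ _).symm
    _ ≤ Real.exp (N * (-(r / (2 * N))) ^ 2) * Real.exp (-(r / (2 * N) * r)) := by
        gcongr
        exact expect_exp_deviation_le hy ht
    _ = _ := by
        rw [← Real.exp_add]
        congr 1
        field_simp
        ring

open Classical in
/-- The Paley-Zygmund inequality. -/
theorem paley_zygmund {W : Ω → ℝ} {a b : ℝ} (ha : 0 ≤ a) (hb : 0 < b)
    (h1 : a ≤ 𝔼 s, W s) (h2 : 𝔼 s, W s ^ 2 ≤ b) :
    a ^ 2 / (4 * b) ≤ 𝔼 s, (if a / 2 ≤ W s then (1 : ℝ) else 0) := by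
  set I : Ω → ℝ := fun s => if a / 2 ≤ W s then (1 : ℝ) else 0
  have hI : ∀ s, I s ^ 2 = I s := fun s => by simp only [I]; split_ifs <;> norm_num
  have h3 : a / 2 ≤ 𝔼 s, W s * I s := by
    have : 𝔼 s, W s ≤ 𝔼 s, (a / 2 + W s * I s) := by
      refine Finset.expect_le_expect fun s _ => ?_
      simp only [I]
      split_ifs with h <;> linarith
    rw [Finset.expect_add_distrib, Fintype.expect_const] at this
    linarith
  have h4 := Finset.expect_mul_sq_le_sq_mul_sq univ W I
  simp only [hI] at h4
  have h5 : 0 ≤ 𝔼 s, I s := Finset.expect_nonneg fun s _ => by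
    simp only [I]; split_ifs <;> norm_num
  rw [div_le_iff₀ (by positivity)]
  nlinarith [mul_le_mul_of_nonneg_right h2 h5]

-- Anti-concentration from exponential moments: Paley-Zygmund is applied to `exp (t * deviation)`
-- with `t = l / √N`. Its mean is at least `exp (l ^ 2 v / 8)` and its second moment at most `exp (4
-- l ^ 2)`, both independent of `N`.
open Classical in
theorem le_expect_deviation_ge [DecidableEq ι] {y : ι → Ω → ℝ} (hy : ∀ j r, |y j r| ≤ 1)
    {v R l : ℝ} (hv0 : 0 ≤ v) (hv1 : v ≤ 1) (hv : ∀ j, v ≤ 𝔼 r, (y j r - 𝔼 r, y j r) ^ 2)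
    (hl0 : 0 < l) (hl : 4 * l ≤ √(Fintype.card ι)) (hR : R * l + 1 ≤ l ^ 2 * v / 8) :
    Real.exp (-(4 * l ^ 2)) / 4
      ≤ 𝔼 s, (if R * √(Fintype.card ι) ≤ deviation y s then (1 : ℝ) else 0) := by
  set N : ℝ := (Fintype.card ι : ℝ) with hN
  have hN0 : 0 ≤ N := Nat.cast_nonneg _
  have hw : 0 < √N := by linarith
  have hwN : √N ^ 2 = N := Real.sq_sqrt hN0
  have hNt : N * (l / √N) ^ 2 = l ^ 2 := by
    rw [div_pow, hwN]
    have : N ≠ 0 := by nlinarith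
    field_simp
  -- The second moment uses the exponent `2t`, which must still be at most `1/2`.
  have ht : l / √N ≤ 1 / 4 := by
    rw [div_le_iff₀ hw]
    linarith
  have ht0 : 0 ≤ l / √N := by positivity
  have hlow := le_expect_exp_deviation hy (t := l / √N)
    (by rw [abs_of_nonneg ht0]; linarith) hv0 hv1 hv
  have hup := expect_exp_deviation_le hy (t := 2 * (l / √N))
    (by rw [abs_of_nonneg (by positivity)]; linarith)
  rw [← hN] at hlow hup
  have e1 : N * ((l / √N) ^ 2 * v / 8) = l ^ 2 * v / 8 := by linear_combination v / 8 * hNt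
  have e2 : N * (2 * (l / √N)) ^ 2 = 4 * l ^ 2 := by linear_combination 4 * hNt
  rw [e1] at hlow
  rw [e2] at hup
  have hpz := paley_zygmund (W := fun s => Real.exp (l / √N * deviation y s))
    (Real.exp_pos _).le (Real.exp_pos (4 * l ^ 2)) hlow (by
      refine le_of_eq_of_le (Finset.expect_congr rfl fun s _ => ?_) hup
      rw [← Real.exp_nat_mul]
      congr 1
      push_cast
      ring)
  calc Real.exp (-(4 * l ^ 2)) / 4
      ≤ Real.exp (l ^ 2 * v / 8) ^ 2 / (4 * Real.exp (4 * l ^ 2)) := by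
        rw [Real.exp_neg, div_le_div_iff₀ (by norm_num) (by positivity)]
        have : 1 ≤ Real.exp (l ^ 2 * v / 8) := Real.one_le_exp (by positivity)
        have h4 : (Real.exp (4 * l ^ 2))⁻¹ * (4 * Real.exp (4 * l ^ 2)) = 4 := by
          field_simp
        rw [h4]
        nlinarith
    _ ≤ _ := hpz
    _ ≤ _ := by
        refine Finset.expect_le_expect fun s _ => ?_
        split_ifs with h h'
        · exact le_rfl
        · exfalso
          apply h'
          -- The `+ 1` in `hR` absorbs the factor 2 of Paley-Zygmund, since `2 ≤ exp 1`.
          have h2 : Real.exp (R * l) ≤ Real.exp (l ^ 2 * v / 8) / 2 := by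
            have : Real.exp (R * l) * Real.exp 1 ≤ Real.exp (l ^ 2 * v / 8) := by
              rw [← Real.exp_add]
              exact Real.exp_le_exp.2 hR
            have h2 : 2 ≤ Real.exp 1 := by linarith [Real.add_one_le_exp 1]
            nlinarith [Real.exp_pos (R * l)]
          have h3 := Real.exp_le_exp.1 (h2.trans h)
          rw [div_mul_eq_mul_div, le_div_iff₀ hw] at h3
          nlinarith
        · norm_num
        · exact le_rfl

end Averages

end Slush

/-! ### Spreading of opinions to undecided parties. -/

namespace Slush

variable {n k : ℕ}

/-- The parties without an opinion. -/
def undecided (x : NetState n) : Finset (Fin n) := univ.filter fun i => x i = none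

/-- The parties with an opinion. -/
def decided (x : NetState n) : Finset (Fin n) := univ.filter fun i => x i ≠ none

theorem mem_undecided {x : NetState n} {i : Fin n} : i ∈ undecided x ↔ x i = none := by
  simp [undecided]

theorem mem_decided {x : NetState n} {i : Fin n} : i ∈ decided x ↔ x i ≠ none := by
  simp [decided]

theorem card_undecided_add_card_decided (x : NetState n) :
    (undecided x).card + (decided x).card = n := by
  have := Finset.card_filter_add_card_filter_not (s := univ) fun i => x i = none
  simpa [undecided, decided] using this

open Classical in
/-- The parties without an opinion that receive no query. -/
noncomputable def unqueried (z : NetState n) (s : Samples n k) : Finset (Fin n) :=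
  (undecided z).filter fun i => ∀ j ∈ decided z, ∀ l, s j l ≠ i

/-- Arrival order influences which opinion is adopted, never who adopts one. -/
theorem undecided_slushStep {z : NetState n} {s : Samples n k} {first : Fin n → Fin n}
    (α : ℕ) (hf : IsArrival z s first) : undecided (slushStep α z s first) = unqueried z s := by
  ext i
  simp only [mem_undecided, unqueried, mem_filter, mem_decided, slushStep, afterQueries]
  by_cases hz : z i = none
  · by_cases hq : ∃ j, Queries z s j i
    · have h1 : z (first i) ≠ none := (hf i hq).1
      obtain ⟨j, hj, l, hl⟩ := hq
      have h2 : ∃ j, Queries z s j i := ⟨j, hj, l, hl⟩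
      simp only [hz, h2, and_self, if_true, h1, true_and, false_iff]
      exact fun h => h j hj l hl
    · simp only [hz, hq, and_false, if_false, if_true, true_and, true_iff]
      exact fun j hj l hl => hq ⟨j, hj, l, hl⟩
  · simp only [hz, if_false, false_and, iff_false]
    split_ifs <;> simp [hz]

theorem undecided_subset_of_isCorruption {F : ℝ} {x z : NetState n} (h : IsCorruption F x z) :
    undecided z ⊆ undecided x := by
  intro i hi
  rw [mem_undecided] at *
  by_contra hx
  exact h.2 i (by rw [hi]; exact Ne.symm hx) hi

theorem card_undecided_le (z : NetState n) (s : Samples n k) :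
    (undecided z).card ≤ (unqueried z s).card + k * (decided z).card := by
  classical
  have hsub : undecided z ⊆ unqueried z s ∪
      ((decided z) ×ˢ (univ : Finset (Fin k))).image fun p => s p.1 p.2 := by
    intro i hi
    by_cases h : ∀ j ∈ decided z, ∀ l, s j l ≠ i
    · exact mem_union_left _ (mem_filter.2 ⟨hi, h⟩)
    · push Not at h
      obtain ⟨j, hj, l, hl⟩ := h
      exact mem_union_right _ (mem_image.2 ⟨(j, l), by simp [hj], hl⟩)
  calc (undecided z).card ≤ _ := card_le_card hsub
    _ ≤ _ := card_union_le _ _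
    _ ≤ (unqueried z s).card + ((decided z) ×ˢ (univ : Finset (Fin k))).card :=
        Nat.add_le_add_left card_image_le _
    _ = _ := by rw [card_product, card_univ, Fintype.card_fin, mul_comm]

theorem expect_ne [NeZero n] (i : Fin n) :
    𝔼 r : Fin n, (if r ≠ i then (1 : ℝ) else 0) = 1 - 1 / n := by
  have : ∀ r : Fin n, (if r ≠ i then (1 : ℝ) else 0) = 1 - if r = i then 1 else 0 := by
    intro r
    by_cases h : r = i <;> simp [h]
  simp_rw [this]
  rw [Finset.expect_sub_distrib, Fintype.expect_const, Fintype.expect_eq_sum_div_card]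
  simp

open Classical in
theorem expect_not_queried [NeZero n] (z : NetState n) (i : Fin n) :
    𝔼 s : Samples n k, (if ∀ j ∈ decided z, ∀ l, s j l ≠ i then (1 : ℝ) else 0)
      = (1 - 1 / n) ^ (k * (decided z).card) := by
  have h1 : ∀ s : Samples n k, (if ∀ j ∈ decided z, ∀ l, s j l ≠ i then (1 : ℝ) else 0)
      = ∏ j, ∏ l, (if j ∈ decided z → s j l ≠ i then (1 : ℝ) else 0) := by
    intro s
    simp only [Finset.prod_boole, mem_univ, true_imp_iff]
    congr 1
    exact propext ⟨fun h j l hj => h j hj l, fun h j hj l => h j l hj⟩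
  simp_rw [h1]
  rw [expect_pi_prod (fun j (r : Fin k → Fin n) =>
    ∏ l, (if j ∈ decided z → r l ≠ i then (1 : ℝ) else 0))]
  have h2 : ∀ j : Fin n, 𝔼 r : Fin k → Fin n,
      ∏ l, (if j ∈ decided z → r l ≠ i then (1 : ℝ) else 0)
      = if j ∈ decided z then (1 - 1 / (n : ℝ)) ^ k else 1 := by
    intro j
    rw [expect_pi_prod (fun (_ : Fin k) (a : Fin n) =>
      (if j ∈ decided z → a ≠ i then (1 : ℝ) else 0))]
    by_cases hj : j ∈ decided z
    · simp only [hj, true_imp_iff, expect_ne]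
      simp
    · simp [hj]
  simp_rw [h2]
  rw [Finset.prod_ite_mem, univ_inter, prod_const, ← pow_mul]

theorem expect_card_unqueried [NeZero n] (z : NetState n) :
    𝔼 s : Samples n k, ((unqueried z s).card : ℝ)
      = (undecided z).card * (1 - 1 / n) ^ (k * (decided z).card) := by
  classical
  simp only [unqueried, Finset.card_filter, Nat.cast_sum, Nat.cast_ite, Nat.cast_one, Nat.cast_zero]
  rw [Finset.expect_sum_comm]
  simp_rw [expect_not_queried]
  simp

/-- Since `(1 - e) ^ m * (1 + e) ^ m ≤ 1`, Bernoulli gives `(1 - e) ^ m ≤ 1 / (1 + m e)`, and `1 /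
(1 + x) ≤ 1 - x / 2` on `[0, 1]`. -/
theorem one_sub_inv_pow_le {m : ℕ} (hmn : m ≤ n) : (1 - 1 / (n : ℝ)) ^ m ≤ 1 - m / (2 * n) := by
  rcases Nat.eq_zero_or_pos n with rfl | hn
  · obtain rfl : m = 0 := by omega
    simp
  have hn' : (1 : ℝ) ≤ n := by exact_mod_cast hn
  set e : ℝ := 1 / n
  have he0 : 0 ≤ e := by positivity
  have he1 : e ≤ 1 := by rw [div_le_one (by linarith)]; exact hn'
  have hme : m * e ≤ 1 := by
    rw [mul_one_div, div_le_one (by linarith)]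
    exact_mod_cast hmn
  have h1 : 1 + m * e ≤ (1 + e) ^ m := one_add_mul_le_pow (by linarith) m
  have h2 : (1 - e) ^ m * (1 + e) ^ m ≤ 1 := by
    rw [← mul_pow]
    exact pow_le_one₀ (by nlinarith) (by nlinarith)
  have h3 : (1 - e) ^ m * (1 + m * e) ≤ 1 :=
    (mul_le_mul_of_nonneg_left h1 (pow_nonneg (by linarith) m)).trans h2
  have h4 : (m : ℝ) / (2 * n) = m * e / 2 := by
    simp only [e]
    field_simp
  rw [h4]
  have h5 : 0 ≤ m * e := by positivity
  have h6 : 1 ≤ (1 - m * e / 2) * (1 + m * e) := by nlinarith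
  exact le_of_mul_le_mul_right (h3.trans h6) (by linarith)

/-- The odds are convex in `u`, hence lie below a chord. The range limit `U - u ≤ κ m` keeps `N - u
≤ (κ + 1) m`, which gives the slope. The bound is affine in `u`, so only the mean of `u` is needed.
-/
theorem div_le_chord {N u U m κ : ℝ} (hm : 0 < m) (hN : U + m = N) (hκ : 0 ≤ κ) (hu : u ≤ U)
    (hu0 : 0 ≤ u) (h : U ≤ u + κ * m) :
    u / (N - u) ≤ U / m - N / ((κ + 1) * m ^ 2) * (U - u) := by
  have hNu : 0 < N - u := by linarith
  have hκ1 : 0 < κ + 1 := by linarith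
  have h1 : U / m - u / (N - u) = N * (U - u) / (m * (N - u)) := by
    field_simp
    rw [← hN]
    ring
  have h2 : N / ((κ + 1) * m ^ 2) * (U - u) ≤ N * (U - u) / (m * (N - u)) := by
    rw [div_mul_eq_mul_div]
    refine div_le_div_of_nonneg_left (mul_nonneg ?_ ?_) (by positivity) ?_ <;> nlinarith
  linarith

/-- The ratio of undecided to decided parties if `u` of the `n` parties are undecided. -/
noncomputable def oddsOf (n u : ℕ) : ℝ := u / ((n : ℝ) - u)

theorem oddsOf_nonneg {u : ℕ} (h : u ≤ n) : 0 ≤ oddsOf n u :=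
  div_nonneg (Nat.cast_nonneg _) (by rw [sub_nonneg]; exact_mod_cast h)

theorem expect_oddsOf_unqueried_le (hk : 1 ≤ k) {z : NetState n} (hz : (decided z).Nonempty) :
    𝔼 s : Samples n k, oddsOf n (unqueried z s).card
      ≤ (1 - 1 / (2 * (k + 1))) * oddsOf n (undecided z).card := by
  have hsum := card_undecided_add_card_decided z
  have hpos := hz.card_pos
  have : NeZero n := ⟨by omega⟩
  set U := (undecided z).card
  set m := (decided z).card
  have hsum' : (U : ℝ) + m = n := by exact_mod_cast hsum
  have hm : (0 : ℝ) < m := by exact_mod_cast hpos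
  have hn : (0 : ℝ) < n := by linarith [(Nat.cast_nonneg U : (0 : ℝ) ≤ U)]
  have hk0 : (0 : ℝ) ≤ k := Nat.cast_nonneg k
  calc 𝔼 s : Samples n k, oddsOf n (unqueried z s).card
      ≤ 𝔼 s : Samples n k,
          ((U : ℝ) / m - n / ((k + 1) * m ^ 2) * (U - (unqueried z s).card)) := by
        refine Finset.expect_le_expect fun s _ => ?_
        refine div_le_chord hm hsum' hk0 ?_ (Nat.cast_nonneg _) ?_
        · exact_mod_cast card_le_card (filter_subset _ _)
        · exact_mod_cast card_undecided_le z s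
    _ = (U : ℝ) / m - n / ((k + 1) * m ^ 2) * (U - U * (1 - 1 / n) ^ (k * m)) := by
        rw [Finset.expect_sub_distrib, Fintype.expect_const, ← Finset.mul_expect,
          Finset.expect_sub_distrib, Fintype.expect_const, expect_card_unqueried]
    _ ≤ (U : ℝ) / m - n / ((k + 1) * m ^ 2) * (U * (m / (2 * n))) := by
        -- Only `m` of the `k * m` queries are used, so that the exponent is at most `n`.
        have h1 : (1 - 1 / (n : ℝ)) ^ (k * m) ≤ 1 - m / (2 * n) := by
          refine le_trans (pow_le_pow_of_le_one ?_ ?_ (Nat.le_mul_of_pos_left m hk))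
            (one_sub_inv_pow_le (by omega))
          · rw [sub_nonneg, div_le_one hn]
            exact_mod_cast NeZero.one_le
          · have : 0 ≤ 1 / (n : ℝ) := by positivity
            linarith
        have h2 : (U : ℝ) * (m / (2 * n)) ≤ U - U * (1 - 1 / n) ^ (k * m) := by
          nlinarith [(Nat.cast_nonneg U : (0 : ℝ) ≤ U)]
        have h3 : (0 : ℝ) ≤ n / ((k + 1) * m ^ 2) := by positivity
        nlinarith
    _ = _ := by
        rw [oddsOf, ← hsum', add_sub_cancel_left]
        have : (U : ℝ) + m ≠ 0 := by linarith
        field_simp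

theorem oddsOf_mono {u u' : ℕ} (h : u ≤ u') (h' : u' < n) : oddsOf n u ≤ oddsOf n u' := by
  have h1 : (u : ℝ) ≤ u' := by exact_mod_cast h
  have h2 : (u' : ℝ) < n := by exact_mod_cast h'
  exact div_le_div₀ (Nat.cast_nonneg _) h1 (by linarith) (by linarith)

end Slush

/-! ### Majority sampling: drift and variance of one update. -/

namespace Slush

/-- The probability that at least `α` of `k` independent events of probability `p` occur. -/
noncomputable def tail (k α : ℕ) (p : ℝ) : ℝ :=
  ∑ T : Finset (Fin k), if α ≤ T.card then p ^ T.card * (1 - p) ^ (k - T.card) else 0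

theorem tail_term_nonneg {k : ℕ} (α : ℕ) {p : ℝ} (hp0 : 0 ≤ p) (hp1 : p ≤ 1) (T : Finset (Fin k)) :
    0 ≤ if α ≤ T.card then p ^ T.card * (1 - p) ^ (k - T.card) else 0 := by
  have : 0 ≤ 1 - p := by linarith
  split_ifs <;> positivity

theorem pow_le_tail {k α : ℕ} (hα : α ≤ k) {p : ℝ} (hp0 : 0 ≤ p) (hp1 : p ≤ 1) :
    p ^ k ≤ tail k α p := by
  have := Finset.single_le_sum (fun T _ => tail_term_nonneg α hp0 hp1 T)
    (mem_univ (univ : Finset (Fin k)))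
  simpa [hα, tail] using this

theorem swap_powers_nonneg {p q : ℝ} (hq : 0 ≤ q) (hpq : q ≤ p) {i j : ℕ} (hij : i ≤ j) :
    0 ≤ p ^ j * q ^ i - q ^ j * p ^ i := by
  obtain ⟨e, rfl⟩ := Nat.exists_eq_add_of_le hij
  have h1 : q ^ e ≤ p ^ e := pow_le_pow_left₀ hq hpq e
  have hp : 0 ≤ p := hq.trans hpq
  have h2 : p ^ (i + e) * q ^ i - q ^ (i + e) * p ^ i = (p * q) ^ i * (p ^ e - q ^ e) := by
    rw [pow_add, pow_add, mul_pow]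
    ring
  rw [h2]
  exact mul_nonneg (by positivity) (by linarith)

/-- The left side of the drift is a sum over winning sets `T` of `p ^ |T| q ^ (k - |T| + 1)` minus
the same with `p` and `q = 1 - p` exchanged. Each term is nonnegative because `|T| ≥ k - |T| + 1`;
the full set alone gives the bound. -/
theorem tail_drift {k α : ℕ} (hk : 2 ≤ k) (hα : α ≤ k) (hkα : k < 2 * α) {p : ℝ}
    (hp : 1 / 2 ≤ p) (hp1 : p ≤ 1) :
    p * (1 - p) * (2 * p - 1) * (1 / 2) ^ (k - 2)
      ≤ tail k α p * (1 - p) - tail k α (1 - p) * p := by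
  have hq : 0 ≤ 1 - p := by linarith
  have hqp : 1 - p ≤ p := by linarith
  have key : tail k α p * (1 - p) - tail k α (1 - p) * p = ∑ T : Finset (Fin k),
      if α ≤ T.card then p ^ T.card * (1 - p) ^ (k - T.card + 1)
        - (1 - p) ^ T.card * p ^ (k - T.card + 1) else 0 := by
    rw [tail, tail, Finset.sum_mul, Finset.sum_mul, ← Finset.sum_sub_distrib]
    refine Finset.sum_congr rfl fun T _ => ?_
    split_ifs
    · rw [sub_sub_cancel]
      ring
    · ring
  rw [key]
  have hsingle := Finset.single_le_sum (f := fun T : Finset (Fin k) =>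
      if α ≤ T.card then p ^ T.card * (1 - p) ^ (k - T.card + 1)
        - (1 - p) ^ T.card * p ^ (k - T.card + 1) else 0) (fun T _ => by
      split_ifs with h
      · have hT : T.card ≤ k := by simpa using card_le_univ T
        exact swap_powers_nonneg hq hqp (by omega)
      · exact le_rfl) (mem_univ (univ : Finset (Fin k)))
  refine le_trans ?_ hsingle
  simp only [card_univ, Fintype.card_fin, hα, if_true, Nat.sub_self, zero_add, pow_one]
  obtain ⟨e, rfl⟩ := Nat.exists_eq_add_of_le hk
  rw [Nat.add_sub_cancel_left]
  have h1 : (1 - p) ^ e ≤ p ^ e := pow_le_pow_left₀ hq hqp e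
  have h2 : (1 / 2 : ℝ) ^ e ≤ p ^ e := pow_le_pow_left₀ (by norm_num) hp e
  have h3 : p ^ (2 + e) * (1 - p) - (1 - p) ^ (2 + e) * p
      = p * (1 - p) * ((2 * p - 1) * p ^ e + (1 - p) * (p ^ e - (1 - p) ^ e)) := by
    rw [pow_add, pow_add]
    ring
  rw [h3, mul_assoc (p * (1 - p))]
  refine mul_le_mul_of_nonneg_left ?_ (by nlinarith)
  nlinarith

variable {n k : ℕ}

theorem expect_indicator [NeZero n] (P : Fin n → Prop) [DecidablePred P] :
    𝔼 r : Fin n, (if P r then (1 : ℝ) else 0) = (univ.filter P).card / n := by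
  rw [Fintype.expect_eq_sum_div_card, Finset.sum_boole, Fintype.card_fin]

theorem expect_indicator_not [NeZero n] (P : Fin n → Prop) [DecidablePred P] :
    𝔼 r : Fin n, (if P r then (0 : ℝ) else 1) = 1 - (univ.filter P).card / n := by
  have : ∀ r, (if P r then (0 : ℝ) else 1) = 1 - if P r then 1 else 0 := by
    intro r
    split_ifs <;> norm_num
  simp_rw [this]
  rw [Finset.expect_sub_distrib, Fintype.expect_const, expect_indicator]

/-- The event is split according to the exact set `T` of draws that satisfy `P`; each piece is a
product over the draws. -/
theorem expect_filter_card_ge [NeZero n] (P : Fin n → Prop) [DecidablePred P] (α : ℕ) :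
    𝔼 r : Fin k → Fin n, (if α ≤ (univ.filter fun l => P (r l)).card then (1 : ℝ) else 0)
      = tail k α ((univ.filter P).card / n) := by
  have h1 : ∀ r : Fin k → Fin n,
      (if α ≤ (univ.filter fun l => P (r l)).card then (1 : ℝ) else 0)
        = ∑ T : Finset (Fin k), (if α ≤ T.card then (1 : ℝ) else 0) *
          ∏ l, if l ∈ T then (if P (r l) then (1 : ℝ) else 0) else if P (r l) then 0 else 1 := by
    intro r
    have h2 : ∀ T : Finset (Fin k),
        (∏ l, if l ∈ T then (if P (r l) then (1 : ℝ) else 0) else if P (r l) then 0 else 1)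
          = if T = univ.filter fun l => P (r l) then 1 else 0 := by
      intro T
      have h3 : ∀ l, (if l ∈ T then (if P (r l) then (1 : ℝ) else 0) else if P (r l) then 0 else 1)
          = if l ∈ T ↔ P (r l) then 1 else 0 := by
        intro l
        by_cases hl : l ∈ T <;> by_cases hP : P (r l) <;> simp [hl, hP]
      simp only [h3, Finset.prod_boole, mem_univ, true_imp_iff, Finset.ext_iff, mem_filter,
        true_and]
    simp_rw [h2]
    simp
  simp_rw [h1]
  rw [Finset.expect_sum_comm, tail]
  refine Finset.sum_congr rfl fun T _ => ?_
  rw [← Finset.mul_expect, expect_pi_prod (fun (l : Fin k) (a : Fin n) =>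
    if l ∈ T then (if P a then (1 : ℝ) else 0) else if P a then 0 else 1)]
  have h4 : ∀ l : Fin k, 𝔼 a : Fin n,
      (if l ∈ T then (if P a then (1 : ℝ) else 0) else if P a then 0 else 1)
        = if l ∈ T then ((univ.filter P).card / n : ℝ) else 1 - (univ.filter P).card / n := by
    intro l
    by_cases hl : l ∈ T
    · simp only [hl, if_true, expect_indicator]
    · simp only [hl, if_false, expect_indicator_not]
  simp_rw [h4]
  rw [Finset.prod_ite, prod_const, prod_const, Finset.filter_not, Finset.filter_mem_eq_inter,
    univ_inter, card_sdiff_of_subset (subset_univ _), card_univ, Fintype.card_fin]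
  split_ifs <;> simp

/-- `1` for the opinion `b`, and `-1` for everything else. -/
def sign (b : Bool) (o : Option Bool) : ℝ := if o = some b then 1 else -1

/-- The number of parties with opinion `b` minus the number of the other parties. -/
def balance (b : Bool) (x : NetState n) : ℝ := ∑ i, sign b (x i)

/-- The number of parties with opinion `b`. -/
def support (b : Bool) (x : NetState n) : ℕ := (univ.filter fun i => x i = some b).card

theorem balance_eq (b : Bool) (x : NetState n) : balance b x = 2 * support b x - n := by
  have : ∀ i, sign b (x i) = 2 * (if x i = some b then 1 else 0) - 1 := by
    intro i
    rw [sign]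
    split_ifs <;> norm_num
  simp only [balance, this, Finset.sum_sub_distrib, ← Finset.mul_sum, Finset.sum_boole, support]
  simp

theorem sign_not (b : Bool) {o : Option Bool} (ho : o ≠ none) : sign (!b) o = -sign b o := by
  cases o with
  | none => exact absurd rfl ho
  | some c => cases b <;> cases c <;> simp [sign]

theorem balance_not (b : Bool) {x : NetState n} (hx : ∀ i, x i ≠ none) :
    balance (!b) x = -balance b x := by
  simp only [balance, ← Finset.sum_neg_distrib]
  exact Finset.sum_congr rfl fun i _ => sign_not b (hx i)

/-- The opinion of party `j` after a round in which it has sampled `r`, if all parties have an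
opinion at the beginning of the round. -/
def updated (α : ℕ) (z : NetState n) (j : Fin n) (r : Fin k → Fin n) : Option Bool :=
  if α ≤ (univ.filter fun l => z (r l) = some true).card then some true
  else if α ≤ (univ.filter fun l => z (r l) = some false).card then some false
  else z j

theorem slushStep_eq_updated {z : NetState n} (hz : ∀ i, z i ≠ none) (α : ℕ) (s : Samples n k)
    (first : Fin n → Fin n) (j : Fin n) : slushStep α z s first j = updated α z j (s j) := by
  have : afterQueries z s first = z := by
    funext i
    simp [afterQueries, hz i]
  simp only [slushStep, this, hz j, if_false, votes, updated]

/-- The sign of the opinion of party `j` after a round. -/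
def signUpdated (α : ℕ) (b : Bool) (z : NetState n) (j : Fin n) (r : Fin k → Fin n) : ℝ :=
  sign b (updated α z j r)

theorem balance_slushStep {z : NetState n} (hz : ∀ i, z i ≠ none) (α : ℕ) (b : Bool)
    (s : Samples n k) (first : Fin n → Fin n) :
    balance b (slushStep α z s first) = ∑ j, signUpdated α b z j (s j) :=
  Finset.sum_congr rfl fun j _ => by rw [slushStep_eq_updated hz, signUpdated]

theorem abs_signUpdated_le (α : ℕ) (b : Bool) (z : NetState n) (j : Fin n) (r : Fin k → Fin n) :
    |signUpdated α b z j r| ≤ 1 := by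
  rw [signUpdated, sign]
  split_ifs <;> norm_num

/-- The indicator of `α` replies `b` in the sample `r`. -/
def wins (α : ℕ) (b : Bool) (z : NetState n) (r : Fin k → Fin n) : ℝ :=
  if α ≤ (univ.filter fun l => z (r l) = some b).card then 1 else 0

theorem card_votes_add {z : NetState n} (hz : ∀ i, z i ≠ none) (r : Fin k → Fin n) :
    (univ.filter fun l => z (r l) = some true).card
      + (univ.filter fun l => z (r l) = some false).card = k := by
  have h := Finset.card_filter_add_card_filter_not (s := univ) fun l => z (r l) = some true
  have h2 : ∀ l, ¬ z (r l) = some true ↔ z (r l) = some false := by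
    intro l
    have := hz (r l)
    cases hl : z (r l) with
    | none => exact absurd hl this
    | some c => cases c <;> simp
  simpa [h2] using h

/-- As `2α > k`, at most one opinion wins, so the order in which the update tests the two opinions
is immaterial. The last term covers ties. -/
theorem signUpdated_eq {α : ℕ} (hkα : k < 2 * α) {z : NetState n} (hz : ∀ i, z i ≠ none) (b : Bool)
    (j : Fin n) (r : Fin k → Fin n) :
    signUpdated α b z j r = wins α b z r - wins α (!b) z r
      + (1 - wins α b z r - wins α (!b) z r) * sign b (z j) := by
  have h := card_votes_add hz r
  unfold signUpdated updated wins
  by_cases h1 : α ≤ (univ.filter fun l => z (r l) = some true).card <;>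
  by_cases h2 : α ≤ (univ.filter fun l => z (r l) = some false).card
  · omega
  all_goals cases b <;> simp [h1, h2, sign]

theorem wins_add_wins_le {α : ℕ} (hkα : k < 2 * α) {z : NetState n} (hz : ∀ i, z i ≠ none)
    (b : Bool) (r : Fin k → Fin n) : wins α b z r + wins α (!b) z r ≤ 1 := by
  have h := card_votes_add hz r
  unfold wins
  by_cases h1 : α ≤ (univ.filter fun l => z (r l) = some true).card <;>
  by_cases h2 : α ≤ (univ.filter fun l => z (r l) = some false).card
  · omega
  all_goals cases b <;> simp [h1, h2]

/-- The fraction of the parties with opinion `b`. -/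
noncomputable def fraction (b : Bool) (x : NetState n) : ℝ := support b x / n

theorem balance_eq_fraction [NeZero n] (b : Bool) (x : NetState n) :
    balance b x = n * (2 * fraction b x - 1) := by
  have : (n : ℝ) ≠ 0 := by exact_mod_cast NeZero.ne n
  rw [balance_eq, fraction]
  field_simp

theorem fraction_not [NeZero n] (b : Bool) {x : NetState n} (hx : ∀ i, x i ≠ none) :
    fraction (!b) x = 1 - fraction b x := by
  have h := balance_not b hx
  rw [balance_eq_fraction, balance_eq_fraction] at h
  have : (n : ℝ) ≠ 0 := by exact_mod_cast NeZero.ne n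
  have h2 : (n : ℝ) * (2 * (fraction (!b) x + fraction b x - 1)) = 0 := by linarith
  rcases mul_eq_zero.1 h2 with h2 | h2
  · exact absurd h2 this
  · linarith

theorem fraction_le_one (b : Bool) (x : NetState n) : fraction b x ≤ 1 := by
  rw [fraction]
  refine div_le_one_of_le₀ ?_ (Nat.cast_nonneg n)
  have := card_le_univ (univ.filter fun i => x i = some b)
  rw [Fintype.card_fin] at this
  exact_mod_cast this

theorem expect_wins [NeZero n] (α : ℕ) (b : Bool) (z : NetState n) :
    𝔼 r : Fin k → Fin n, wins α b z r = tail k α (fraction b z) :=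
  expect_filter_card_ge (fun i => z i = some b) α

theorem expect_signUpdated [NeZero n] {α : ℕ} (hkα : k < 2 * α) {z : NetState n}
    (hz : ∀ i, z i ≠ none) (b : Bool) (j : Fin n) :
    𝔼 r : Fin k → Fin n, signUpdated α b z j r
      = tail k α (fraction b z) - tail k α (1 - fraction b z)
        + (1 - tail k α (fraction b z) - tail k α (1 - fraction b z)) * sign b (z j) := by
  simp_rw [signUpdated_eq hkα hz]
  rw [Finset.expect_add_distrib, ← Finset.expect_mul, Finset.expect_sub_distrib,
    Finset.expect_sub_distrib, Finset.expect_sub_distrib, Fintype.expect_const, expect_wins,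
    expect_wins, fraction_not b hz]

/-- With `p` the fraction of `b` and `A`, `B` the winning probabilities of `b` and its opposite, the
expected balance exceeds the old one by exactly `2n(A(1 - p) - Bp)`, which `tail_drift` bounds. -/
theorem le_sum_expect_signUpdated [NeZero n] {α : ℕ} (hk : 2 ≤ k) (hα : α ≤ k) (hkα : k < 2 * α)
    {z : NetState n} (hz : ∀ i, z i ≠ none) (b : Bool) (hb : 0 ≤ balance b z) :
    balance b z + (1 / 2) ^ (k - 1) * balance b z * (1 - balance b z / n)
      ≤ ∑ j, 𝔼 r : Fin k → Fin n, signUpdated α b z j r := by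
  have hn : (0 : ℝ) < n := by exact_mod_cast NeZero.pos n
  simp_rw [expect_signUpdated hkα hz]
  rw [Finset.sum_add_distrib, ← Finset.mul_sum]
  change _ ≤ _ + _ * balance b z
  have hp1 := fraction_le_one b z
  rw [balance_eq_fraction] at hb ⊢
  set p := fraction b z
  have hp : 1 / 2 ≤ p := by
    have := nonneg_of_mul_nonneg_right hb hn
    linarith
  have hd := tail_drift hk hα hkα hp hp1
  simp only [Finset.sum_const, card_univ, Fintype.card_fin, nsmul_eq_mul]
  rw [mul_div_cancel_left₀ _ hn.ne']
  obtain ⟨e, rfl⟩ := Nat.exists_eq_add_of_le hk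
  rw [Nat.add_sub_cancel_left] at hd
  rw [show 2 + e - 1 = e + 1 by omega, pow_succ]
  set A := tail (2 + e) α p
  set B := tail (2 + e) α (1 - p)
  have h1 : (1 - p) * (2 * p - 1) * (1 / 2) ^ e ≤ 2 * (A * (1 - p) - B * p) := by
    have h0 : 0 ≤ (1 - p) * (2 * p - 1) * (1 / 2 : ℝ) ^ e :=
      mul_nonneg (mul_nonneg (by linarith) (by linarith)) (by positivity)
    nlinarith
  nlinarith [mul_le_mul_of_nonneg_left h1 hn.le]

/-- The variable is `±1`, so its variance is `1 - mean ^ 2`. Each opinion wins with probability at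
least `(1/3) ^ k`, which keeps the mean away from `±1`. -/
theorem le_variance_signUpdated [NeZero n] {α : ℕ} (hα : α ≤ k) (hkα : k < 2 * α)
    {z : NetState n} (hz : ∀ i, z i ≠ none) (b : Bool) (h1 : 1 / 3 ≤ fraction b z)
    (h2 : fraction b z ≤ 2 / 3) (j : Fin n) :
    ((1 / 3 : ℝ) ^ k) ^ 2 ≤ 𝔼 r : Fin k → Fin n,
      (signUpdated α b z j r - 𝔼 r : Fin k → Fin n, signUpdated α b z j r) ^ 2 := by
  rw [expect_centered_sq, expect_signUpdated hkα hz]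
  have hsq : ∀ r : Fin k → Fin n, signUpdated α b z j r ^ 2 = 1 := by
    intro r
    rw [signUpdated, sign]
    split_ifs <;> norm_num
  simp_rw [hsq]
  rw [Fintype.expect_const]
  have hA : (1 / 3 : ℝ) ^ k ≤ tail k α (fraction b z) :=
    (pow_le_pow_left₀ (by norm_num) h1 k).trans (pow_le_tail hα (by linarith) (by linarith))
  have hB : (1 / 3 : ℝ) ^ k ≤ tail k α (1 - fraction b z) :=
    (pow_le_pow_left₀ (by norm_num) (by linarith) k).trans
      (pow_le_tail hα (by linarith) (by linarith))
  have hAB : tail k α (fraction b z) + tail k α (1 - fraction b z) ≤ 1 := by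
    rw [← fraction_not b hz, ← expect_wins, ← expect_wins, ← Finset.expect_add_distrib]
    exact Finset.expect_le univ_nonempty fun r _ => wins_add_wins_le hkα hz b r
  have he : 0 < (1 / 3 : ℝ) ^ k := by positivity
  rw [sign]
  split_ifs <;> nlinarith

end Slush

/-! ### Contraction of the minority ratio, far from and near to balance. -/

namespace Slush

/-- The minority-to-balance ratio of `n` parties with opinions whose balance is `S`, where the
balance is rounded up to `K * √n`. -/
noncomputable def minorityRatio (K : ℝ) (n : ℕ) (S : ℝ) : ℝ :=
  (n - |S|) / (2 * max |S| (K * √n))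

theorem minorityRatio_abs (K : ℝ) (n : ℕ) (S : ℝ) :
    minorityRatio K n |S| = minorityRatio K n S := by
  simp [minorityRatio]

theorem minorityRatio_neg (K : ℝ) (n : ℕ) (S : ℝ) :
    minorityRatio K n (-S) = minorityRatio K n S := by
  simp [minorityRatio]

variable {n k : ℕ}

theorem minorityRatio_nonneg {K S : ℝ} (hS : |S| ≤ n) : 0 ≤ minorityRatio K n S := by
  have : 0 ≤ max |S| (K * √n) := (abs_nonneg S).trans (le_max_left _ _)
  exact div_nonneg (by linarith) (by linarith)

theorem minorityRatio_le {K L S : ℝ} (hS : |S| ≤ n) (hL : 0 < L) (h : L ≤ max |S| (K * √n)) :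
    minorityRatio K n S ≤ (n - |S|) / (2 * L) :=
  div_le_div_of_nonneg_left (by linarith) (by linarith) (by linarith)

theorem minorityRatio_le_of_le {K L S : ℝ} (hS : |S| ≤ n) (hL : 0 < L)
    (h : L ≤ max |S| (K * √n)) : minorityRatio K n S ≤ n / (2 * L) :=
  (minorityRatio_le hS hL h).trans
    (div_le_div_of_nonneg_right (by linarith [abs_nonneg S]) (by linarith))

theorem minorityRatio_le_sqrt {K S : ℝ} (hK : 0 < K) (hn : 0 < n) (hS : |S| ≤ n) :
    minorityRatio K n S ≤ √n / (2 * K) := by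
  have hw : 0 < √(n : ℝ) := Real.sqrt_pos.2 (by exact_mod_cast hn)
  refine (minorityRatio_le_of_le hS (mul_pos hK hw) (le_max_right _ _)).trans_eq ?_
  have : (n : ℝ) = √n * √n := (Real.mul_self_sqrt (Nat.cast_nonneg n)).symm
  rw [div_eq_div_iff (by positivity) (by positivity)]
  linear_combination 2 * K * this

/-- The effect of the drift alone. The numerator sits at the mean `μ`, the denominator at `μ -
δΔ/2`, a level that the balance reaches outside the Chernoff failure event. -/
theorem drift_ratio_le {N δ Δ μ : ℝ} (hN : 0 < N) (hδ0 : 0 < δ) (hδ1 : δ ≤ 1 / 2) (hΔ0 : 0 < Δ)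
    (hΔN : Δ ≤ N) (hμ : Δ + δ * Δ * (1 - Δ / N) ≤ μ) :
    0 < μ - δ * Δ / 2 ∧
      (N - μ) / (2 * (μ - δ * Δ / 2)) ≤ (N - Δ) / (2 * Δ) / (1 + δ / 2) := by
  set u := Δ / N with hu
  have hu0 : 0 ≤ u := by positivity
  have hu1 : u ≤ 1 := (div_le_one hN).2 hΔN
  have huN : u * N = Δ := by rw [hu]; field_simp
  have hL : Δ * (1 + δ / 2 - δ * u) ≤ μ - δ * Δ / 2 := by linarith
  have hpos : 0 < 1 + δ / 2 - δ * u := by nlinarith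
  have hL0 : 0 < μ - δ * Δ / 2 := (mul_pos hΔ0 hpos).trans_le hL
  refine ⟨hL0, ?_⟩
  have h1 : N - μ ≤ (N - Δ) * (1 - δ * u) := by
    have : Δ * (1 - u) = u * (N - Δ) := by linear_combination -huN
    nlinarith
  rw [div_div, div_le_div_iff₀ (by positivity) (by positivity)]
  have h2 : (1 - δ * u) * (1 + δ / 2) ≤ 1 + δ / 2 - δ * u := by nlinarith [mul_nonneg hδ0.le hu0]
  calc (N - μ) * (2 * Δ * (1 + δ / 2))
      ≤ (N - Δ) * (1 - δ * u) * (2 * Δ * (1 + δ / 2)) := by gcongr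
    _ = (N - Δ) * (2 * Δ) * ((1 - δ * u) * (1 + δ / 2)) := by ring
    _ ≤ (N - Δ) * (2 * Δ) * (1 + δ / 2 - δ * u) :=
        mul_le_mul_of_nonneg_left h2 (mul_nonneg (by linarith) (by linarith))
    _ = (N - Δ) * (2 * (Δ * (1 + δ / 2 - δ * u))) := by ring
    _ ≤ (N - Δ) * (2 * (μ - δ * Δ / 2)) :=
        mul_le_mul_of_nonneg_left (by linarith) (by linarith)

/-- Here `w = √n`. On failure the ratio may be as large as `w / (2K)` with `K = 64 / δ ^ 2`; the
crude bound `exp (-Y) ≤ 1 / Y` on the failure probability already makes this a small part of the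
current ratio. -/
theorem failure_term_le {w δ D Δ P : ℝ} (hw : 0 < w) (hδ0 : 0 < δ) (hδ1 : δ ≤ 1 / 2)
    (hD : 64 / δ ^ 2 * w ≤ D) (hgap : 2 * w ≤ δ / 16 * (w ^ 2 - D)) (hΔ : D / 2 ≤ Δ)
    (hP : P ≤ Real.exp (-((δ * Δ / 2) ^ 2 / (4 * w ^ 2)))) :
    w / (2 * (64 / δ ^ 2)) * P ≤ δ / 16 * ((w ^ 2 - D) / (2 * D)) := by
  have hD0 : 0 < D := lt_of_lt_of_le (by positivity) hD
  have hD' : 64 * w ≤ δ ^ 2 * D := by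
    rw [div_mul_eq_mul_div, div_le_iff₀ (by positivity)] at hD
    linarith
  have hy : δ ^ 2 * D ^ 2 / (64 * w ^ 2) ≤ (δ * Δ / 2) ^ 2 / (4 * w ^ 2) := by
    rw [div_le_div_iff₀ (by positivity) (by positivity)]
    have : D ^ 2 ≤ (2 * Δ) ^ 2 := pow_le_pow_left₀ hD0.le (by linarith) 2
    have h2 : 0 ≤ δ ^ 2 * w ^ 2 := by positivity
    nlinarith
  have hP2 : P ≤ 64 * w ^ 2 / (δ ^ 2 * D ^ 2) := by
    refine hP.trans ((Real.exp_le_exp.2 (neg_le_neg hy)).trans ?_)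
    rw [← inv_div (δ ^ 2 * D ^ 2)]
    set Y := δ ^ 2 * D ^ 2 / (64 * w ^ 2)
    have hy0 : 0 < Y := by positivity
    rw [Real.exp_neg]
    exact inv_anti₀ hy0 (by linarith [Real.add_one_le_exp Y])
  -- For `D ≤ w ^ 2 / 2` the factor `D ≥ K w` suffices; for larger `D` the gap hypothesis bounds `w
  -- ^ 2 - D` from below.
  have hmain : 16 * w ^ 3 ≤ δ * D * (w ^ 2 - D) := by
    rcases le_total D (w ^ 2 / 2) with h | h
    · have h1 : w ^ 2 / 2 ≤ w ^ 2 - D := by linarith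
      have h2 : 64 * w ≤ δ * D := by nlinarith [mul_pos hδ0 hD0]
      calc 16 * w ^ 3 ≤ 64 * w * (w ^ 2 / 2) := by nlinarith [pow_pos hw 3]
        _ ≤ δ * D * (w ^ 2 - D) := by gcongr
    · have h1 : 32 * w ≤ δ * (w ^ 2 - D) := by linarith
      calc 16 * w ^ 3 = w ^ 2 / 2 * (32 * w) := by ring
        _ ≤ D * (δ * (w ^ 2 - D)) := by gcongr
        _ = _ := by ring
  calc w / (2 * (64 / δ ^ 2)) * P
      ≤ w / (2 * (64 / δ ^ 2)) * (64 * w ^ 2 / (δ ^ 2 * D ^ 2)) := by gcongr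
    _ = 16 * w ^ 3 / (32 * D ^ 2) := by
        field_simp
        ring
    _ ≤ δ * D * (w ^ 2 - D) / (32 * D ^ 2) := by gcongr
    _ = _ := by
        field_simp
        ring

/-- The budget: the adversary costs `(1 + δ/16) ^ 2`, one factor each for numerator and denominator;
the drift gains `1 + δ/2`; the failure event costs `δ/16`. The outcome is at most `1 - 3δ/16 +
δ/16`. -/
theorem contraction_far_aux {w δ D Δ μ P : ℝ} (hw : 0 < w) (hδ0 : 0 < δ) (hδ1 : δ ≤ 1 / 2)
    (hD : 64 / δ ^ 2 * w ≤ D) (hgap : 2 * w ≤ δ / 16 * (w ^ 2 - D)) (hΔ : D - 2 * w ≤ Δ)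
    (hΔw : Δ ≤ w ^ 2) (hμ : Δ + δ * Δ * (1 - Δ / w ^ 2) ≤ μ)
    (hP : P ≤ Real.exp (-((δ * Δ / 2) ^ 2 / (4 * w ^ 2)))) :
    (w ^ 2 - μ) / (2 * (μ - δ * Δ / 2)) + w / (2 * (64 / δ ^ 2)) * P
      ≤ (1 - δ / 8) * ((w ^ 2 - D) / (2 * D)) := by
  have hD0 : 0 < D := lt_of_lt_of_le (by positivity) hD
  have hD' : 64 * w ≤ δ ^ 2 * D := by
    rw [div_mul_eq_mul_div, div_le_iff₀ (by positivity)] at hD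
    linarith
  have hwD : 64 * w ≤ δ * D / 2 := by nlinarith [mul_pos hδ0 hD0]
  have hwD2 : 64 * w ≤ D := by nlinarith
  have hΔD : D / 2 ≤ Δ := by linarith
  have hΔ0 : 0 < Δ := by linarith
  have hgap0 : 0 < w ^ 2 - D := by
    by_contra h
    nlinarith
  have h1 := (drift_ratio_le (by positivity) hδ0 hδ1 hΔ0 hΔw hμ).2
  have h2 := failure_term_le hw hδ0 hδ1 hD hgap hΔD hP
  have h3 : (w ^ 2 - Δ) / (2 * Δ) ≤ (1 + δ / 16) ^ 2 * ((w ^ 2 - D) / (2 * D)) := by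
    rw [← mul_div_assoc, div_le_div_iff₀ (by positivity) (by positivity)]
    have h4 : w ^ 2 - Δ ≤ (1 + δ / 16) * (w ^ 2 - D) := by linarith
    have h5 : D ≤ (1 + δ / 16) * Δ := by nlinarith
    calc (w ^ 2 - Δ) * (2 * D) ≤ (1 + δ / 16) * (w ^ 2 - D) * (2 * ((1 + δ / 16) * Δ)) := by
          gcongr
      _ = _ := by ring
  set X := (w ^ 2 - D) / (2 * D)
  have hX : 0 ≤ X := by positivity
  have h6 : (1 + δ / 16) ^ 2 * X / (1 + δ / 2) ≤ (1 - 3 * δ / 16) * X := by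
    rw [div_le_iff₀ (by positivity)]
    have : (1 + δ / 16) ^ 2 ≤ (1 - 3 * δ / 16) * (1 + δ / 2) := by nlinarith
    nlinarith [mul_le_mul_of_nonneg_right this hX]
  have h7 : (w ^ 2 - Δ) / (2 * Δ) / (1 + δ / 2) ≤ (1 + δ / 16) ^ 2 * X / (1 + δ / 2) := by gcongr
  linarith

theorem abs_sum_signUpdated_le (α : ℕ) (b : Bool) (z : NetState n) (s : Samples n k) :
    |∑ j, signUpdated α b z j (s j)| ≤ n := by
  refine (Finset.abs_sum_le_sum_abs _ _).trans ?_
  refine (Finset.sum_le_sum fun j _ => abs_signUpdated_le α b z j (s j)).trans ?_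
  simp

theorem abs_balance_le (b : Bool) (x : NetState n) : |balance b x| ≤ n := by
  refine (Finset.abs_sum_le_sum_abs _ _).trans ?_
  refine (Finset.sum_le_sum (g := fun _ => (1 : ℝ)) fun j _ => ?_).trans ?_
  · rw [sign]
    split_ifs <;> norm_num
  · simp

theorem expect_minorityRatio_far_le [NeZero n] {α : ℕ} (hk : 2 ≤ k) (hα : α ≤ k)
    (hkα : k < 2 * α) {z : NetState n} (hz : ∀ i, z i ≠ none) (b : Bool) {δ D : ℝ}
    (hδ : δ = (1 / 2) ^ (k - 1)) (hD : 64 / δ ^ 2 * √n ≤ D)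
    (hgap : 2 * √n ≤ δ / 16 * (n - D)) (hΔ : D - 2 * √n ≤ balance b z) :
    𝔼 s : Samples n k, minorityRatio (64 / δ ^ 2) n (∑ j, signUpdated α b z j (s j))
      ≤ (1 - δ / 8) * minorityRatio (64 / δ ^ 2) n D := by
  classical
  have hn : (0 : ℝ) < n := by exact_mod_cast NeZero.pos n
  have hw : 0 < √(n : ℝ) := Real.sqrt_pos.2 hn
  have hwn : √(n : ℝ) ^ 2 = n := Real.sq_sqrt hn.le
  have hδ0 : 0 < δ := by rw [hδ]; positivity
  have hδ1 : δ ≤ 1 / 2 := by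
    rw [hδ]
    calc (1 / 2 : ℝ) ^ (k - 1) ≤ (1 / 2) ^ 1 :=
          pow_le_pow_of_le_one (by norm_num) (by norm_num) (by omega)
      _ = 1 / 2 := pow_one _
  have hK : 0 < 64 / δ ^ 2 := by positivity
  have hD0 : 0 < D := lt_of_lt_of_le (by positivity) hD
  have hΔn : balance b z ≤ n := (le_abs_self _).trans (abs_balance_le b z)
  have hΔ0 : 0 < balance b z := by
    have : 2 < 64 / δ ^ 2 := by
      rw [lt_div_iff₀ (by positivity)]
      nlinarith
    nlinarith
  have hμ := le_sum_expect_signUpdated hk hα hkα hz b hΔ0.le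
  rw [← hδ] at hμ
  set Δ := balance b z
  set μ := ∑ j, 𝔼 r : Fin k → Fin n, signUpdated α b z j r with hμdef
  set y : Fin n → (Fin k → Fin n) → ℝ := signUpdated α b z
  have hy : ∀ j r, |y j r| ≤ 1 := abs_signUpdated_le α b z
  obtain ⟨hL, -⟩ := drift_ratio_le hn hδ0 hδ1 hΔ0 hΔn hμ
  set L := μ - δ * Δ / 2 with hLdef
  have hdev := expect_deviation_lt_le hy (r := δ * Δ / 2) (by positivity) (by
    rw [Fintype.card_fin]
    nlinarith)
  rw [Fintype.card_fin] at hdev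
  set I : Samples n k → ℝ := fun s => if deviation y s < -(δ * Δ / 2) then (1 : ℝ) else 0
  have hES : 𝔼 s : Samples n k, ∑ j, y j (s j) = μ := by
    rw [Finset.expect_sum_comm]
    exact Finset.sum_congr rfl fun j _ => expect_pi_apply j (y j)
  -- Freezing the denominator at `L` makes the main term affine in the new balance, so its mean is
  -- explicit.
  have hpt : ∀ s : Samples n k, minorityRatio (64 / δ ^ 2) n (∑ j, y j (s j))
      ≤ (n - ∑ j, y j (s j)) / (2 * L) + √n / (2 * (64 / δ ^ 2)) * I s := by
    intro s
    have hS : |∑ j, y j (s j)| ≤ n := abs_sum_signUpdated_le α b z s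
    have hS' := (le_abs_self _).trans hS
    by_cases h : deviation y s < -(δ * Δ / 2)
    · simp only [I, h, if_true, mul_one]
      have h1 : 0 ≤ (n - ∑ j, y j (s j)) / (2 * L) := div_nonneg (by linarith) (by linarith)
      linarith [minorityRatio_le_sqrt hK (NeZero.pos n) hS]
    · simp only [I, h, if_false, mul_zero, add_zero]
      have hLS : L ≤ ∑ j, y j (s j) := by
        rw [deviation, not_lt] at h
        linarith
      rw [← abs_of_nonneg (hL.le.trans hLS)] at hLS
      refine (minorityRatio_le hS hL (hLS.trans (le_max_left _ _))).trans ?_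
      gcongr
      exact le_abs_self _
  calc _ ≤ 𝔼 s : Samples n k,
        ((n - ∑ j, y j (s j)) / (2 * L) + √n / (2 * (64 / δ ^ 2)) * I s) :=
        Finset.expect_le_expect fun s _ => hpt s
    _ = (n - μ) / (2 * L) + √n / (2 * (64 / δ ^ 2)) * 𝔼 s, I s := by
        rw [Finset.expect_add_distrib, ← Finset.expect_div, Finset.expect_sub_distrib, hES,
          Fintype.expect_const, Finset.mul_expect]
    _ ≤ (1 - δ / 8) * ((n - D) / (2 * D)) := by
        have := contraction_far_aux (μ := μ) (P := 𝔼 s, I s) hw hδ0 hδ1 hD (by rwa [hwn]) hΔ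
          (by rwa [hwn]) (by rwa [hwn]) (by rwa [hwn])
        rwa [hwn] at this
    _ = _ := by
        rw [minorityRatio, abs_of_pos hD0, max_eq_left hD]

theorem expect_minorityRatio_near_le [NeZero n] {α : ℕ} (hk : 2 ≤ k) (hα : α ≤ k)
    (hkα : k < 2 * α) {z : NetState n} (hz : ∀ i, z i ≠ none) (b : Bool) {K l D c : ℝ}
    (hK : 0 < K) (hl : l = 8 * (2 * K + 1) / ((1 / 3 : ℝ) ^ k) ^ 2)
    (hc : c = Real.exp (-(4 * l ^ 2)) / 4)
    (hw1 : 4 * l ≤ √n) (hw2 : 3 * (K + 2) ≤ √n) (hw3 : 4 * K / c ≤ √n)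
    (hD0 : 0 ≤ D) (hD : D ≤ K * √n) (hΔ0 : 0 ≤ balance b z) (hΔ : balance b z ≤ D + 2 * √n) :
    𝔼 s : Samples n k, minorityRatio K n (∑ j, signUpdated α b z j (s j))
      ≤ (1 - c / 4) * minorityRatio K n D := by
  classical
  have hn : (0 : ℝ) < n := by exact_mod_cast NeZero.pos n
  have hw : 0 < √(n : ℝ) := Real.sqrt_pos.2 hn
  have hwn : √(n : ℝ) ^ 2 = n := Real.sq_sqrt hn.le
  have hv0 : 0 < ((1 / 3 : ℝ) ^ k) ^ 2 := by positivity
  have hv1 : ((1 / 3 : ℝ) ^ k) ^ 2 ≤ 1 :=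
    pow_le_one₀ (by positivity) (pow_le_one₀ (by norm_num) (by norm_num))
  set v := ((1 / 3 : ℝ) ^ k) ^ 2
  have hlv : l * v = 8 * (2 * K + 1) := by rw [hl]; field_simp
  have hl1 : 1 ≤ l := by
    rw [hl, le_div_iff₀ hv0]
    linarith
  have hc0 : 0 < c := by rw [hc]; positivity
  have hΔn : balance b z / n ≤ 1 :=
    div_le_one_of_le₀ ((le_abs_self _).trans (abs_balance_le b z)) hn.le
  have hμ := le_sum_expect_signUpdated hk hα hkα hz b hΔ0
  have hμ0 : 0 ≤ ∑ j, 𝔼 r : Fin k → Fin n, signUpdated α b z j r := by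
    refine le_trans (add_nonneg hΔ0 (mul_nonneg (by positivity) ?_)) hμ
    linarith
  have hf : balance b z = n * (2 * fraction b z - 1) := balance_eq_fraction b z
  have hf1 : 1 / 2 ≤ fraction b z := by
    rw [hf] at hΔ0
    linarith [nonneg_of_mul_nonneg_right hΔ0 hn]
  -- The balance is at most `(K + 2)√n ≤ n / 3`.
  have hf2 : fraction b z ≤ 2 / 3 := by
    have h1 : (n : ℝ) * (2 * fraction b z - 1) ≤ n * (1 / 3) := by
      rw [← hf]
      nlinarith
    linarith [le_of_mul_le_mul_left h1 hn]
  have hy : ∀ j r, |signUpdated (k := k) α b z j r| ≤ 1 := abs_signUpdated_le α b z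
  -- The choice of `l` gives `l ^ 2 v / 8 = (2K + 1) l ≥ 2K l + 1`. A deviation of `2K√n` above a
  -- nonnegative mean doubles the floor `K√n` of the denominator.
  have hdev := le_expect_deviation_ge (R := 2 * K) (l := l) hy hv0.le hv1
    (le_variance_signUpdated hα hkα hz b (by linarith) hf2) (by linarith)
    (by rwa [Fintype.card_fin]) (by nlinarith)
  rw [Fintype.card_fin, ← hc] at hdev
  set y : Fin n → (Fin k → Fin n) → ℝ := signUpdated α b z
  set I : Samples n k → ℝ := fun s => if 2 * K * √n ≤ deviation y s then (1 : ℝ) else 0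
  have hpt : ∀ s : Samples n k, minorityRatio K n (∑ j, y j (s j))
      ≤ √n / (2 * K) * (1 - 1 / 2 * I s) := by
    intro s
    have hS : |∑ j, y j (s j)| ≤ n := abs_sum_signUpdated_le α b z s
    by_cases h : 2 * K * √n ≤ deviation y s
    · simp only [I, h, if_true, mul_one]
      have hLS : 2 * K * √n ≤ |∑ j, y j (s j)| := by
        rw [deviation] at h
        linarith [le_abs_self (∑ j, y j (s j))]
      refine (minorityRatio_le_of_le hS (by positivity) (hLS.trans (le_max_left _ _))).trans_eq ?_
      rw [← hwn, Real.sqrt_sq hw.le]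
      field_simp
      norm_num
    · simp only [I, h, if_false, mul_zero, sub_zero, mul_one]
      exact minorityRatio_le_sqrt hK (NeZero.pos n) hS
  calc _ ≤ 𝔼 s : Samples n k, √n / (2 * K) * (1 - 1 / 2 * I s) :=
        Finset.expect_le_expect fun s _ => hpt s
    _ = √n / (2 * K) * (1 - 1 / 2 * 𝔼 s, I s) := by
        rw [← Finset.mul_expect, Finset.expect_sub_distrib, Fintype.expect_const,
          ← Finset.mul_expect]
    _ ≤ √n / (2 * K) * (1 - 1 / 2 * c) := by gcongr
    -- Half of the gain `c / 2` pays for the old ratio being slightly below its maximum `√n / (2K)`.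
    _ ≤ √n / (2 * K) * ((1 - c / 4) * (1 - K / √n)) := by
        have h1 : K / √n ≤ c / 4 := by
          rw [div_le_iff₀ hc0] at hw3
          rw [div_le_iff₀ hw]
          linarith
        have h2 : 0 ≤ K / √n := by positivity
        gcongr
        nlinarith
    _ = (1 - c / 4) * ((√n ^ 2 - K * √n) / (2 * (K * √n))) := by
        field_simp
    _ ≤ _ := by
        have hc1 : c ≤ 1 := by
          rw [hc]
          have : Real.exp (-(4 * l ^ 2)) ≤ 1 := Real.exp_le_one_iff.2 (by nlinarith)
          linarith
        rw [minorityRatio, abs_of_nonneg hD0, max_eq_right hD, hwn]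
        gcongr
        linarith

end Slush

/-! ### The potential: contraction, bounds and choice of constants. -/

namespace Slush

variable {n k : ℕ}

theorem abs_balance_sub_le {F : ℝ} {x z : NetState n} (h : IsCorruption F x z) (b : Bool) :
    |balance b z - balance b x| ≤ 2 * F := by
  rw [balance, balance, ← Finset.sum_sub_distrib]
  calc _ ≤ ∑ i, |sign b (z i) - sign b (x i)| := Finset.abs_sum_le_sum_abs _ _
    _ ≤ ∑ i, 2 * (if z i ≠ x i then (1 : ℝ) else 0) := by
        refine Finset.sum_le_sum fun i _ => ?_
        by_cases hi : z i = x i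
        · simp [hi]
        · simp only [ne_eq, hi, not_false_eq_true, if_true]
          unfold sign
          split_ifs <;> norm_num
    _ = 2 * ((univ.filter fun i => z i ≠ x i).card : ℝ) := by
        rw [← Finset.mul_sum, Finset.sum_boole]
    _ ≤ 2 * F := by linarith [h.1]

theorem exists_balance_eq_abs {x : NetState n} (hx : ∀ i, x i ≠ none) :
    ∃ b, balance b x = |balance true x| := by
  rcases le_total 0 (balance true x) with h | h
  · exact ⟨true, (abs_of_nonneg h).symm⟩
  · exact ⟨false, by rw [abs_of_nonpos h, ← balance_not true hx, Bool.not_true]⟩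

theorem minorityRatio_balance {x : NetState n} (hx : ∀ i, x i ≠ none) (K : ℝ) (b : Bool) :
    minorityRatio K n (balance b x) = minorityRatio K n (balance true x) := by
  cases b
  · rw [← Bool.not_true, balance_not true hx, minorityRatio_neg]
  · rfl

theorem abs_balance_lt {g : ℕ → ℝ} {x : NetState n} (hx : ∀ i, x i ≠ none)
    (h : ¬ IsStableConsensus g x) : |balance true x| < n - 2 * g n := by
  obtain ⟨b, hb⟩ := exists_balance_eq_abs hx
  rw [← hb, balance_eq]
  have : (support b x : ℝ) < n - g n := lt_of_not_ge fun h' => h ⟨b, h'⟩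
  linarith

theorem forall_ne_none_of_undecided_eq_empty {x : NetState n} (h : undecided x = ∅) (i : Fin n) :
    x i ≠ none := by
  rw [← mem_decided]
  by_contra hi
  have : i ∈ undecided x := mem_undecided.2 (by simpa [mem_decided] using hi)
  simp [h] at this

theorem card_undecided_lt {x : NetState n} (h : (decided x).Nonempty) :
    (undecided x).card < n := by
  have := card_undecided_add_card_decided x
  have := h.card_pos
  omega

theorem decided_nonempty_of_card_lt {x : NetState n} (h : (undecided x).card < n) :
    (decided x).Nonempty := by
  have := card_undecided_add_card_decided x
  exact card_pos.1 (by omega)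

/-- The potential function on states in which some party has an opinion. -/
noncomputable def realPotential (K : ℝ) (x : NetState n) : ℝ :=
  n ^ 2 * oddsOf n (undecided x).card
    + if undecided x = ∅ then minorityRatio K n (balance true x) else 0

open Classical in
/-- The potential function: it shrinks in mean until stable consensus is reached. -/
noncomputable def potential (K : ℝ) (x : NetState n) : ℝ≥0∞ :=
  if (decided x).Nonempty then ENNReal.ofReal (realPotential K x) else ⊤

theorem one_div_le_oddsOf {u : ℕ} (h0 : 0 < u) (hu : u < n) : 1 / (n : ℝ) ≤ oddsOf n u := by
  have h1 : (1 : ℝ) ≤ u := by exact_mod_cast h0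
  have h2 : (u : ℝ) < n := by exact_mod_cast hu
  exact div_le_div₀ (by linarith) h1 (by linarith) (by linarith)

theorem oddsOf_le {u : ℕ} (hu : u < n) : oddsOf n u ≤ n := by
  have h1 : (u : ℝ) + 1 ≤ n := by exact_mod_cast hu
  have h0 : (0 : ℝ) ≤ u := Nat.cast_nonneg u
  rw [oddsOf, div_le_iff₀ (by linarith)]
  nlinarith

theorem realPotential_slushStep_le {K : ℝ} (hK : 0 < K) (hn : 0 < n) {z : NetState n}
    {s : Samples n k} {first : Fin n → Fin n} (α : ℕ) (hf : IsArrival z s first) :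
    realPotential K (slushStep α z s first)
      ≤ n ^ 2 * oddsOf n (unqueried z s).card + √n / (2 * K) := by
  rw [realPotential, undecided_slushStep α hf]
  gcongr
  split_ifs
  · exact minorityRatio_le_sqrt hK hn (abs_balance_le _ _)
  · positivity

/-- With an undecided party left, the weighted odds are at least `n`. Half of their contraction
therefore pays for the term `√n / (2K)`, the largest minority ratio that can appear if the round
leaves nobody undecided. -/
theorem expect_spread_le [NeZero n] (hk : 1 ≤ k) {K F : ℝ} (hK : 1 ≤ K)
    (hw : 2 * ((k : ℝ) + 1) ≤ √n) {x z : NetState n} (hxz : IsCorruption F x z)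
    (hx : (decided x).Nonempty) (hU : undecided x ≠ ∅) :
    𝔼 s : Samples n k, ((n : ℝ) ^ 2 * oddsOf n (unqueried z s).card + √n / (2 * K))
      ≤ (1 - 1 / (4 * (k + 1))) * (n ^ 2 * oddsOf n (undecided x).card) := by
  have hn : (0 : ℝ) < n := by exact_mod_cast NeZero.pos n
  have hwn : √(n : ℝ) ^ 2 = n := Real.sq_sqrt hn.le
  have hsub := card_le_card (undecided_subset_of_isCorruption hxz)
  have hlt := card_undecided_lt hx
  have hzd : (decided z).Nonempty := decided_nonempty_of_card_lt (by omega)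
  have h1 := expect_oddsOf_unqueried_le hk hzd
  have h2 := oddsOf_mono hsub hlt
  have h3 := one_div_le_oddsOf (card_pos.2 (nonempty_iff_ne_empty.2 hU)) hlt
  have hk0 : (0 : ℝ) ≤ k := Nat.cast_nonneg k
  set o := oddsOf n (undecided x).card
  have h4 : (n : ℝ) ≤ n ^ 2 * o := by
    calc (n : ℝ) = n ^ 2 * (1 / n) := by field_simp
      _ ≤ _ := by gcongr
  have h5 : √(n : ℝ) / (2 * K) ≤ 1 / (4 * (k + 1)) * (n ^ 2 * o) := by
    calc √(n : ℝ) / (2 * K) ≤ √n / 2 := by gcongr; linarith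
      _ = 1 / (4 * ((k : ℝ) + 1)) * (√n * (2 * (k + 1))) := by
          field_simp
          norm_num
      _ ≤ 1 / (4 * ((k : ℝ) + 1)) * (√n * √n) := by gcongr
      _ = 1 / (4 * ((k : ℝ) + 1)) * n := by rw [← sq, hwn]
      _ ≤ _ := by gcongr
  have h6 : 1 / (2 * ((k : ℝ) + 1)) ≤ 1 := by
    rw [div_le_one (by positivity)]
    linarith
  have h7 : 1 / (2 * ((k : ℝ) + 1)) = 1 / (4 * (k + 1)) + 1 / (4 * (k + 1)) := by
    field_simp
    norm_num
  rw [Finset.expect_add_distrib, ← Finset.mul_expect, Fintype.expect_const]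
  calc _ ≤ (n : ℝ) ^ 2 * ((1 - 1 / (2 * (k + 1))) * o) + 1 / (4 * (k + 1)) * (n ^ 2 * o) := by
        gcongr
        exact h1.trans (mul_le_mul_of_nonneg_left h2 (by linarith))
    _ = _ := by rw [h7]; ring

theorem expect_consensus_le [NeZero n] {α : ℕ} (hk : 2 ≤ k) (hα : α ≤ k) (hkα : k < 2 * α)
    {δ K l c ρ : ℝ} (hδ : δ = (1 / 2) ^ (k - 1)) (hK : K = 64 / δ ^ 2)
    (hl : l = 8 * (2 * K + 1) / ((1 / 3 : ℝ) ^ k) ^ 2) (hc : c = Real.exp (-(4 * l ^ 2)) / 4)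
    (hρ1 : 1 - δ / 8 ≤ ρ) (hρ2 : 1 - c / 4 ≤ ρ)
    (hw1 : 4 * l ≤ √n) (hw2 : 3 * (K + 2) ≤ √n) (hw3 : 4 * K / c ≤ √n)
    (hw4 : (16 / δ) ^ 2 ≤ √n) {g : ℕ → ℝ} (hg : √n * √√n ≤ g n)
    {x z : NetState n} (hxz : IsCorruption √n x z) (hU : undecided x = ∅)
    (hx : ¬ IsStableConsensus g x) :
    ∃ b, 𝔼 s : Samples n k, minorityRatio K n (∑ j, signUpdated α b z j (s j))
      ≤ ρ * minorityRatio K n (balance true x) := by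
  have hx' := forall_ne_none_of_undecided_eq_empty hU
  have hz' : ∀ i, z i ≠ none := forall_ne_none_of_undecided_eq_empty
    (subset_empty.1 (hU ▸ undecided_subset_of_isCorruption hxz))
  have hδ0 : 0 < δ := by rw [hδ]; positivity
  have hK0 : 0 < K := by rw [hK]; positivity
  have hnn : 0 ≤ minorityRatio K n (balance true x) := minorityRatio_nonneg (abs_balance_le _ _)
  obtain ⟨bx, hbx⟩ := exists_balance_eq_abs hx'
  obtain ⟨bz, hbz⟩ := exists_balance_eq_abs hz'
  rcases le_total (K * √n) |balance true x| with hD | hD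
  · refine ⟨bx, ?_⟩
    -- This is where the size of `g` enters: without consensus the gap exceeds `2 n ^ (3/4)`, and
    -- `16 / δ ≤ n ^ (1/4)`.
    have hgap : 2 * √n ≤ δ / 16 * (n - |balance true x|) := by
      have h1 := abs_balance_lt hx' hx
      have h2 : 16 / δ ≤ √√n := Real.le_sqrt_of_sq_le hw4
      rw [div_le_iff₀ hδ0] at h2
      have h3 : 0 ≤ √(n : ℝ) := Real.sqrt_nonneg _
      nlinarith [mul_le_mul_of_nonneg_left h2 h3, mul_le_mul_of_nonneg_left hg hδ0.le]
    have hΔ := (abs_le.1 (abs_balance_sub_le hxz bx)).1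
    rw [hK] at hD
    have := expect_minorityRatio_far_le hk hα hkα hz' bx hδ hD hgap (by linarith)
    rw [minorityRatio_abs, ← hK] at this
    exact this.trans (mul_le_mul_of_nonneg_right hρ1 hnn)
  · refine ⟨bz, ?_⟩
    have hΔ := (abs_le.1 (abs_balance_sub_le hxz bz)).2
    have hbx' : balance bz x ≤ |balance true x| := by
      cases bz
      · rw [← Bool.not_true, balance_not true hx']
        exact neg_le_abs _
      · exact le_abs_self _
    have := expect_minorityRatio_near_le hk hα hkα hz' bz hK0 hl hc hw1 hw2 hw3
      (abs_nonneg _) hD (hbz ▸ abs_nonneg _) (by linarith)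
    rw [minorityRatio_abs] at this
    exact this.trans (mul_le_mul_of_nonneg_right hρ2 hnn)

theorem oddsOf_zero (n : ℕ) : oddsOf n 0 = 0 := by simp [oddsOf]

theorem isContracting_potential [NeZero n] {α : ℕ} (hk : 2 ≤ k) (hα : α ≤ k) (hkα : k < 2 * α)
    {δ K l c ρ : ℝ} (hδ : δ = (1 / 2) ^ (k - 1)) (hK : K = 64 / δ ^ 2)
    (hl : l = 8 * (2 * K + 1) / ((1 / 3 : ℝ) ^ k) ^ 2) (hc : c = Real.exp (-(4 * l ^ 2)) / 4)
    (hρ0 : 0 < ρ) (hρ1 : 1 - δ / 8 ≤ ρ) (hρ2 : 1 - c / 4 ≤ ρ)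
    (hρ3 : 1 - 1 / (4 * ((k : ℝ) + 1)) ≤ ρ) (hK1 : 1 ≤ K)
    (hw1 : 4 * l ≤ √n) (hw2 : 3 * (K + 2) ≤ √n) (hw3 : 4 * K / c ≤ √n)
    (hw4 : (16 / δ) ^ 2 ≤ √n) (hw5 : 2 * ((k : ℝ) + 1) ≤ √n)
    {g : ℕ → ℝ} (hg : √n * √√n ≤ g n) :
    IsContracting (n := n) k α g √n (potential K) (ENNReal.ofReal ρ) := by
  intro x z hx hxz
  by_cases hxd : (decided x).Nonempty
  swap
  -- If nobody has an opinion the potential is `⊤`, and `ρ * ⊤ = ⊤` because `ρ ≠ 0`.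
  · refine ⟨fun _ => ⊤, fun _ _ _ => le_top, ?_⟩
    have : ENNReal.ofReal ρ ≠ 0 := by simpa using hρ0
    simp [potential, hxd, ENNReal.mul_top this]
  have hK0 : 0 < K := by linarith
  have hsub := card_le_card (undecided_subset_of_isCorruption hxz)
  have hlt := card_undecided_lt hxd
  have hstep : ∀ s : Samples n k, ∀ first, IsArrival z s first →
      potential K (slushStep α z s first)
        = ENNReal.ofReal (realPotential K (slushStep α z s first)) := by
    intro s first hf
    refine if_pos (decided_nonempty_of_card_lt ?_)
    rw [undecided_slushStep α hf]
    exact ((card_le_card (filter_subset _ _)).trans hsub).trans_lt hlt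
  rw [potential, if_pos hxd, ← ENNReal.ofReal_mul hρ0.le]
  by_cases hU : undecided x = ∅
  · have hzU : undecided z = ∅ := subset_empty.1 (hU ▸ undecided_subset_of_isCorruption hxz)
    have hz' := forall_ne_none_of_undecided_eq_empty hzU
    obtain ⟨b, hb⟩ := expect_consensus_le hk hα hkα hδ hK hl hc hρ1 hρ2 hw1 hw2 hw3 hw4 hg hxz hU hx
    refine ⟨fun s => ENNReal.ofReal (minorityRatio K n (∑ j, signUpdated α b z j (s j))),
      fun s first hf => ?_, ?_⟩
    · have hsU : undecided (slushStep α z s first) = ∅ := by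
        rw [undecided_slushStep α hf, unqueried, hzU, filter_empty]
      rw [hstep s first hf, realPotential, if_pos hsU, hsU, card_empty, oddsOf_zero, mul_zero,
        zero_add, ← minorityRatio_balance (forall_ne_none_of_undecided_eq_empty hsU) K b,
        balance_slushStep hz']
    · rw [mean_uniform_ofReal _ fun s => minorityRatio_nonneg (abs_sum_signUpdated_le α b z s)]
      refine ENNReal.ofReal_le_ofReal ?_
      rw [realPotential, if_pos hU, hU, card_empty, oddsOf_zero, mul_zero, zero_add]
      exact hb
  · refine ⟨fun s => ENNReal.ofReal (n ^ 2 * oddsOf n (unqueried z s).card + √n / (2 * K)),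
      fun s first hf => ?_, ?_⟩
    · rw [hstep s first hf]
      exact ENNReal.ofReal_le_ofReal (realPotential_slushStep_le hK0 (NeZero.pos n) α hf)
    · have hnn : ∀ s : Samples n k,
          0 ≤ (n : ℝ) ^ 2 * oddsOf n (unqueried z s).card + √n / (2 * K) := fun s =>
        add_nonneg (mul_nonneg (by positivity)
          (oddsOf_nonneg (((card_le_card (filter_subset _ _)).trans hsub).trans hlt.le)))
          (by positivity)
      rw [mean_uniform_ofReal _ hnn]
      refine ENNReal.ofReal_le_ofReal ?_
      rw [realPotential, if_neg hU, add_zero]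
      exact (expect_spread_le (by omega) hK1 hw5 hxz hxd hU).trans
        (mul_le_mul_of_nonneg_right hρ3 (mul_nonneg (by positivity) (oddsOf_nonneg hlt.le)))

theorem le_potential [NeZero n] {K : ℝ} (hK : 0 < K) (hKw : K ≤ √n) {g : ℕ → ℝ} (hg : 1 ≤ g n)
    {x : NetState n} (hx : ¬ IsStableConsensus g x) :
    ENNReal.ofReal (1 / n) ≤ potential K x := by
  have hn : (1 : ℝ) ≤ n := by exact_mod_cast NeZero.one_le
  rw [potential]
  split_ifs with hxd
  swap
  · exact le_top
  refine ENNReal.ofReal_le_ofReal ?_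
  rw [realPotential]
  split_ifs with hU
  · have hD := abs_balance_lt (forall_ne_none_of_undecided_eq_empty hU) hx
    rw [hU, card_empty, oddsOf_zero, mul_zero, zero_add, minorityRatio]
    have hmax : max |balance true x| (K * √n) ≤ n := by
      refine max_le (abs_balance_le _ _) ?_
      calc K * √n ≤ √n * √n := by gcongr
        _ = n := Real.mul_self_sqrt (by linarith)
    have hpos : 0 < max |balance true x| (K * √n) := lt_max_of_lt_right (by positivity)
    rw [div_le_div_iff₀ (by linarith) (by linarith)]
    nlinarith
  · have h := one_div_le_oddsOf (card_pos.2 (nonempty_iff_ne_empty.2 hU)) (card_undecided_lt hxd)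
    have h0 : 0 ≤ 1 / (n : ℝ) := by positivity
    rw [add_zero]
    exact h.trans (le_mul_of_one_le_left (h0.trans h) (one_le_pow₀ hn))

theorem potential_le [NeZero n] {K : ℝ} (hK : 1 ≤ K) (hn : 2 ≤ n) {x : NetState n}
    (hx : ∃ i, x i ≠ none) : potential K x ≤ ENNReal.ofReal (n ^ 4) := by
  have hn' : (2 : ℝ) ≤ n := by exact_mod_cast hn
  obtain ⟨i, hi⟩ := hx
  have hxd : (decided x).Nonempty := ⟨i, mem_decided.2 hi⟩
  rw [potential, if_pos hxd]
  refine ENNReal.ofReal_le_ofReal ?_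
  have h1 := oddsOf_le (card_undecided_lt hxd)
  have h2 : (if undecided x = ∅ then minorityRatio K n (balance true x) else 0) ≤ (n : ℝ) := by
    split_ifs
    · refine (minorityRatio_le_sqrt (by linarith) (by omega) (abs_balance_le _ _)).trans ?_
      rw [div_le_iff₀ (by linarith), Real.sqrt_le_iff]
      have h3 : (n : ℝ) ≤ n * (2 * K) := by nlinarith
      exact ⟨by linarith, by nlinarith⟩
    · linarith
  rw [realPotential]
  calc _ ≤ (n : ℝ) ^ 2 * n + n := by gcongr
    _ ≤ n ^ 4 := by nlinarith [pow_pos (show (0 : ℝ) < n by linarith) 3]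

theorem negligible_exp_sub (a : ℝ) : Negligible fun β => Real.exp (a - β) := by
  intro p hp
  have h1 : ∀ᶠ b : ℝ in Filter.atTop, p.eval b / Real.exp b < Real.exp (-a) :=
    (Polynomial.tendsto_div_exp_atTop p).eventually_lt_const (Real.exp_pos _)
  have h2 : ∀ᶠ b : ℝ in Filter.atTop, 0 < p.eval b := by
    rcases Nat.eq_zero_or_pos p.natDegree with h | h
    · rw [Polynomial.eq_C_of_natDegree_eq_zero h] at hp ⊢
      exact Filter.Eventually.of_forall fun b => by simpa using hp
    · exact (p.tendsto_atTop_of_leadingCoeff_nonneg (Polynomial.natDegree_pos_iff_degree_pos.1 h)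
        hp.le).eventually_gt_atTop 0
  obtain ⟨b₀, hb₀⟩ := Filter.eventually_atTop.1 (h1.and h2)
  refine ⟨max b₀ 0, le_max_right _ _, fun b hb => ?_⟩
  obtain ⟨h3, h4⟩ := hb₀ b ((le_max_left _ _).trans hb)
  rw [le_div_iff₀ h4]
  rw [div_lt_iff₀ (Real.exp_pos _), ← Real.exp_add] at h3
  calc Real.exp (a - b) * p.eval b ≤ Real.exp (a - b) * Real.exp (-a + b) := by gcongr
    _ = 1 := by rw [← Real.exp_add]; simp

theorem isLittleO_gap (N : ℝ) :
    (fun n : ℕ => N + √n * √√n) =o[Filter.atTop] (fun n : ℕ => (n : ℝ)) := by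
  refine Asymptotics.IsLittleO.add ?_ ?_
  · exact (Asymptotics.isLittleO_const_id_atTop N).comp_tendsto tendsto_natCast_atTop_atTop
  · have h1 : Filter.Tendsto (fun n : ℕ => √√(n : ℝ)) Filter.atTop Filter.atTop :=
      Real.tendsto_sqrt_atTop.comp
        (Real.tendsto_sqrt_atTop.comp tendsto_natCast_atTop_atTop)
    have h2 : (fun _ : ℕ => (1 : ℝ)) =o[Filter.atTop] fun n : ℕ => √√(n : ℝ) :=
      (Asymptotics.isLittleO_one_left_iff ℝ).2 (tendsto_norm_atTop_atTop.comp h1)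
    refine ((Asymptotics.isBigO_refl (fun n : ℕ => √(n : ℝ) * √√n) Filter.atTop).mul_isLittleO
      h2).congr (fun n => mul_one _) fun n => ?_
    rw [mul_assoc, Real.mul_self_sqrt (Real.sqrt_nonneg _), Real.mul_self_sqrt (Nat.cast_nonneg n)]

theorem reaches_of_forall {g : ℕ → ℝ} (hg : (n : ℝ) ≤ g n) (h : History n k) : h.Reaches g :=
  .of_current ⟨true, by
    have : (0 : ℝ) ≤ ((univ.filter fun i => h.current i = some true).card : ℝ) := Nat.cast_nonneg _
    linarith⟩

/-- The factor `5` in the number of rounds cancels `n ^ 5`; rounding down costs at most `exp a`. -/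
theorem pow_floor_le {a β : ℝ} (ha : 0 < a) (hβ : 0 ≤ β) (hn : 1 ≤ n) :
    (n : ℝ) ^ 5 * Real.exp (-a) ^ ⌊5 / a * (Real.log n + β)⌋₊ ≤ Real.exp (a - β) := by
  have hn0 : (0 : ℝ) < n := by exact_mod_cast hn
  have h5 : (n : ℝ) ^ 5 = Real.exp (5 * Real.log n) := by
    rw [mul_comm, Real.exp_mul, Real.exp_log hn0]
    norm_cast
  rw [h5, ← Real.exp_nat_mul, ← Real.exp_add, Real.exp_le_exp]
  have hfl := Nat.lt_floor_add_one (5 / a * (Real.log n + β))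
  have h1 := mul_le_mul_of_nonneg_left hfl.le ha.le
  have h2 : a * (5 / a * (Real.log n + β)) = 5 * (Real.log n + β) := by field_simp
  rw [h2] at h1
  nlinarith

end Slush

open Slush in
theorem mainTheorem7 (k α : ℕ) (hk : 2 ≤ k) (hα : α = ⌈((k : ℝ) + 1) / 2⌉₊) :
    ∃ (C : ℝ) (g : ℕ → ℝ) (ν : ℝ → ℝ),
      0 < C ∧ g =o[Filter.atTop] (fun n : ℕ => (n : ℝ)) ∧ Negligible ν ∧
      ∀ (n : ℕ) (β : ℝ), 0 ≤ β →
      ∀ (A : BoundedAdversary n k (Real.sqrt n)) (O : ArrivalOrder n k) (x₀ : NetState n),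
        (∃ i, x₀ i ≠ none) →
        (slushLaw α A O x₀ ⌊C * (Real.log n + β)⌋₊).toOuterMeasure {h | ¬ h.Reaches g}
          ≤ ENNReal.ofReal (ν β) := by
  have hk' : (2 : ℝ) ≤ k := by exact_mod_cast hk
  have hαk : α ≤ k := by
    rw [hα]
    refine Nat.ceil_le.2 ?_
    linarith
  have hkα : k < 2 * α := by
    have h : ((k : ℝ) + 1) / 2 ≤ α := hα ▸ Nat.le_ceil _
    have h2 : (k : ℝ) < 2 * α := by linarith
    exact_mod_cast h2
  obtain ⟨δ, hδ⟩ : ∃ δ : ℝ, δ = (1 / 2) ^ (k - 1) := ⟨_, rfl⟩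
  obtain ⟨K, hK⟩ : ∃ K : ℝ, K = 64 / δ ^ 2 := ⟨_, rfl⟩
  obtain ⟨l, hl⟩ : ∃ l : ℝ, l = 8 * (2 * K + 1) / ((1 / 3 : ℝ) ^ k) ^ 2 := ⟨_, rfl⟩
  obtain ⟨c, hc⟩ : ∃ c : ℝ, c = Real.exp (-(4 * l ^ 2)) / 4 := ⟨_, rfl⟩
  have hδ0 : 0 < δ := by rw [hδ]; positivity
  have hδ1 : δ ≤ 1 := by rw [hδ]; exact pow_le_one₀ (by norm_num) (by norm_num)
  have hK1 : 1 ≤ K := by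
    rw [hK, le_div_iff₀ (by positivity)]
    nlinarith
  have hc0 : 0 < c := by rw [hc]; positivity
  have hk4 : 0 < 1 / (4 * ((k : ℝ) + 1)) := by positivity
  -- The common contraction factor of the far, near and spreading regimes is written as `exp (-a)`.
  obtain ⟨a, ha0, ha⟩ : ∃ a : ℝ, 0 < a ∧
      max (max (1 - δ / 8) (1 - c / 4)) (1 - 1 / (4 * ((k : ℝ) + 1))) ≤ Real.exp (-a) := by
    have hmax : max (max (1 - δ / 8) (1 - c / 4)) (1 - 1 / (4 * ((k : ℝ) + 1))) < 1 :=
      max_lt (max_lt (by linarith) (by linarith)) (by linarith)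
    have hpos : 0 < max (max (1 - δ / 8) (1 - c / 4)) (1 - 1 / (4 * ((k : ℝ) + 1))) :=
      lt_max_of_lt_left (lt_max_of_lt_left (by linarith))
    exact ⟨-Real.log _, neg_pos.2 (Real.log_neg hpos hmax), by rw [neg_neg, Real.exp_log hpos]⟩
  simp only [max_le_iff] at ha
  have hsqrt : Filter.Tendsto (fun n : ℕ => √(n : ℝ)) Filter.atTop Filter.atTop :=
    Real.tendsto_sqrt_atTop.comp tendsto_natCast_atTop_atTop
  obtain ⟨N, hN⟩ := Filter.eventually_atTop.1 ((hsqrt.eventually_ge_atTop (4 * l)).and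
    ((hsqrt.eventually_ge_atTop (3 * (K + 2))).and ((hsqrt.eventually_ge_atTop (4 * K / c)).and
    ((hsqrt.eventually_ge_atTop ((16 / δ) ^ 2)).and
    ((hsqrt.eventually_ge_atTop (2 * ((k : ℝ) + 1))).and (Filter.eventually_ge_atTop 2))))))
  -- The constant `N` in the gap makes every state with `n < N` a stable consensus, so the estimates
  -- are needed only for large `n`.
  refine ⟨5 / a, fun n => N + √n * √√n, fun β => Real.exp (a - β), by positivity,
    isLittleO_gap N, negligible_exp_sub a, fun n β hβ A O x₀ hx₀ => ?_⟩
  have hgap : 0 ≤ √(n : ℝ) * √√n := by positivity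
  rcases lt_or_ge n N with hnN | hnN
  · have hle : (n : ℝ) ≤ N + √n * √√n := by
      have : (n : ℝ) ≤ N := by exact_mod_cast hnN.le
      linarith
    have hempty : {h : History n k | ¬ h.Reaches fun n => N + √n * √√n} = ∅ :=
      Set.eq_empty_of_forall_notMem fun h hh =>
        hh (reaches_of_forall (g := fun n => N + √n * √√n) hle h)
    rw [hempty]
    simp
  obtain ⟨hw1, hw2, hw3, hw4, hw5, hn2⟩ := hN n hnN
  have : NeZero n := ⟨by omega⟩
  have hn0 : (0 : ℝ) < n := by exact_mod_cast NeZero.pos n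
  have hV := isContracting_potential (n := n) (g := fun n => N + √n * √√n) hk hαk hkα hδ hK hl hc
    (Real.exp_pos (-a)) ha.1.1 ha.1.2 ha.2 hK1 hw1 hw2 hw3 hw4 hw5 (by simp)
  have hw0 : 1 ≤ √(n : ℝ) := by linarith
  have hmain := not_reaches_mul_le hV (c := ENNReal.ofReal (1 / n))
    (fun x hx => le_potential (by linarith) (by linarith) (by
      have : 1 ≤ √√(n : ℝ) := Real.one_le_sqrt.2 hw0
      nlinarith) hx) A O x₀ ⌊5 / a * (Real.log n + β)⌋₊
  replace hmain := hmain.trans (mul_le_mul_right (potential_le hK1 hn2 hx₀) _)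
  rw [one_div, ENNReal.ofReal_inv_of_pos hn0, ← div_eq_mul_inv,
    ENNReal.div_le_iff (ENNReal.ofReal_pos.2 hn0).ne' ENNReal.ofReal_ne_top,
    ← ENNReal.ofReal_pow (Real.exp_pos _).le, ← ENNReal.ofReal_mul (by positivity),
    ← ENNReal.ofReal_mul (by positivity)] at hmain
  refine hmain.trans (ENNReal.ofReal_le_ofReal ((le_of_eq ?_).trans
    (pow_floor_le ha0 hβ (NeZero.pos n))))
  ring
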